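/- Let $d,d'\ge 0$ be integers, $\alpha\in(1/3,1/2)$, and $M,K,L\ge 0$. All vector norms $\|\cdot\|_\infty$ are maximum norms, $\Delta_n=2^{-n}$ and $t^n_k=k2^{-n}$. Let $\mu:\mathbb R^d\to\mathbb R^d$ be differentiable and $\sigma:\mathbb R^d\to\mathbb R^{d\times d'}$ three times differentiable, such that all components of $\mu$ and $\sigma$, all first partial derivatives of $\mu$, and all partial derivatives of $\sigma$ of order $1,2,3$ are bounded by $M$ in absolute value. Let $Z:[0,1]\to\mathbb R^{d'}$ and $A_{i,j}(s,t)$ ($1\le i,j\le d'$, $0\le s<t\le1$) satisfy $$A_{i,j}(r,t)=A_{i,j}(r,s)+A_{i,j}(s,t)+(Z_i(s)-Z_i(r))(Z_j(t)-Z_j(s)),\qquad 0\le r<s<t\le 1,$$ $$\|Z\|_\alpha=\sup_{0\le s<t\le1}\frac{\|Z(t)-Z(s)\|_\infty}{|t-s|^\alpha}\le K,\qquad \|A\|_{2\alpha}=\sup_{0\le s<t\le1}\max_{i,j}\frac{|A_{i,j}(s,t)|}{|t-s|^{2\alpha}}\le L$$ (for instance a path of Brownian motion with its It\^o iterated integrals).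 Put $$\Phi_i(s,t,x)=\mu_i(x)(t-s)+\sum_{j}\sigma_{i,j}(x)(Z_j(t)-Z_j(s))+\sum_{j,m=1}^{d'}\sum_{l=1}^{d}\partial_l\sigma_{i,j}(x)\,\sigma_{l,m}(x)\,A_{m,j}(s,t).$$ Let $X:[0,1]\to\mathbb R^d$ be a solution of $dX=\mu(X)\,dt+\sigma(X)\,dZ$, $X(0)=x(0)$, driven by $(Z,A)$, that is, $X(0)=x(0)$ and $|X_i(t)-X_i(s)-\Phi_i(s,t,X(s))|=o(t-s)$ for all $i$, uniformly in $0\le s<t\le1$. Let $X^n$ be the Milstein-type scheme with the true areas: $X^n(0)=x(0)$, $$X^n(t^n_{k+1})=X^n(t^n_k)+\Phi(t^n_k,t^n_{k+1},X^n(t^n_k)),\qquad 0\le k<2^n,$$ and $X^n(t)=X^n(\max\{t^n_k: t^n_k\le t\})$ for $t\in[0,1]$. Then there is $n_0$, depending only on $d,d',\alpha,M,K,L$, such that for all $n\ge n_0$ $$\sup_{t\in[0,1]}\|X^n(t)-X(t)\|_\infty\le G_1\,\Delta_n^{3\alpha-1},\qquad G_1=(1+B)\,C_3,$$ where $G_1$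 is given explicitly in terms of $d,d',\alpha,M,K,L$ as follows (one may take $K=\|Z\|_\alpha$, $L=\|A\|_{2\alpha}$). Put $\rho=2/(1-2^{1-3\alpha})$ and $$\kappa(c_1,c_2)=dMc_1+d'K\big(d^2Mc_1^2+dM(c_2+M)\big)+2d^2d'^2M^2L\,c_1 .$$ Further $$c_1=1+M+d'MK+dd'^2M^2L,\quad c_2=1+dd'^2M^2L,\quad c_3=\rho\,\kappa(c_1,c_2),\quad \delta=(2+c_3)^{-1/\alpha},$$ $$C_1=\tfrac2\delta c_1,\qquad C_2=\tfrac2\delta\big(c_2+dMC_1+dd'MK\,C_1\big),\qquad C_3=\rho\,\kappa(C_1,C_2),$$ $$b_1=1+dM+dd'MK+2d^2d'^2M^2L,\qquad b_2=1+dM+2d^2d'^2M^2L,$$ $$b_3=\rho\Big\{d'K\big(d^3MC_1^2+d^2MC_1b_1+d^2M(M+C_2)+dMb_2\big)+d'^2L\big(4d^3M^2C_1+2d^2M^2b_1\big)\Big\},$$ $$\delta'=(2+2b_1+b_3)^{-1/\alpha},\qquad B=(2+2b_1+b_3)\,\big(1+2^{2/\delta'}\big).$$ -/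

import Mathlib

namespace RoughMilstein

noncomputable section

open scoped ENNReal

/-- `∂_l σ_{i,j}(x)`. -/
def partialDeriv {d d' : ℕ} (σ : (Fin d → ℝ) → Fin d → Fin d' → ℝ)
    (l i : Fin d) (j : Fin d') (x : Fin d → ℝ) : ℝ :=
  fderiv ℝ σ x (Pi.single l 1) i j

/-- `μ` is differentiable and `σ` is three times differentiable; the components of `μ` and `σ`, the
first partial derivatives of `μ`, and all partial derivatives of `σ` up to order three are bounded
by `M` on the whole space. -/
structure CoeffBounds {d d' : ℕ} (μ : (Fin d → ℝ) → Fin d → ℝ)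
    (σ : (Fin d → ℝ) → Fin d → Fin d' → ℝ) (M : ℝ) : Prop where
  differentiable_drift : Differentiable ℝ μ
  drift_le : ∀ x i, |μ x i| ≤ M
  fderiv_drift_le : ∀ x l i, |fderiv ℝ μ x (Pi.single l 1) i| ≤ M
  differentiable_diffusion : ∀ k < 3, Differentiable ℝ (iteratedFDeriv ℝ k σ)
  diffusion_le : ∀ k ≤ 3, ∀ (x : Fin d → ℝ) (l : Fin k → Fin d) (i : Fin d) (j : Fin d'),
    |iteratedFDeriv ℝ k σ x (fun a => Pi.single (l a) 1) i j| ≤ M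

/-- `‖Z‖_α = sup_{0 ≤ s < t ≤ 1} ‖Z(t) - Z(s)‖_∞ / |t - s|^α`, possibly infinite. -/
def pathNorm {d' : ℕ} (α : ℝ) (Z : ℝ → Fin d' → ℝ) : ℝ≥0∞ :=
  ⨆ (s : ℝ) (t : ℝ) (_ : 0 ≤ s) (_ : s < t) (_ : t ≤ 1),
    ENNReal.ofReal (‖Z t - Z s‖ / (t - s) ^ α)

/-- `‖A‖_{2α} = sup_{0 ≤ s < t ≤ 1} max_{i,j} |A_{i,j}(s,t)| / |t - s|^{2α}`, possibly infinite. -/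
def areaNorm {d' : ℕ} (α : ℝ) (A : ℝ → ℝ → Fin d' → Fin d' → ℝ) : ℝ≥0∞ :=
  ⨆ (s : ℝ) (t : ℝ) (_ : 0 ≤ s) (_ : s < t) (_ : t ≤ 1) (i : Fin d') (j : Fin d'),
    ENNReal.ofReal (|A s t i j| / (t - s) ^ (2 * α))

/-- The algebraic (Chen) relation satisfied by `A_{i,j}(s,t) = ∫_s^t (Z_i(u) - Z_i(s)) dZ_j(u)`. -/
def IsArea {d' : ℕ} (Z : ℝ → Fin d' → ℝ) (A : ℝ → ℝ → Fin d' → Fin d' → ℝ) : Prop :=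
  ∀ r s t : ℝ, 0 ≤ r → r < s → s < t → t ≤ 1 → ∀ i j,
    A r t i j = A r s i j + A s t i j + (Z s i - Z r i) * (Z t j - Z s j)

/-- The second-order increment over `[s, t]` started from the state `x`:
`μ_i(x)(t-s) + ∑_j σ_{i,j}(x)(Z_j(t)-Z_j(s)) + ∑_{j,l,m} ∂_l σ_{i,j}(x) σ_{l,m}(x) A_{m,j}(s,t)`. -/
def increment {d d' : ℕ} (μ : (Fin d → ℝ) → Fin d → ℝ)
    (σ : (Fin d → ℝ) → Fin d → Fin d' → ℝ) (Z : ℝ → Fin d' → ℝ)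
    (A : ℝ → ℝ → Fin d' → Fin d' → ℝ) (s t : ℝ) (x : Fin d → ℝ) : Fin d → ℝ := fun i =>
  μ x i * (t - s) + ∑ j, σ x i j * (Z t j - Z s j)
    + ∑ j, ∑ l, ∑ m, partialDeriv σ l i j x * σ x l m * A s t m j

/-- `X` solves `dX = μ(X) dt + σ(X) dZ`, `X(0) = x₀`, on `[0, 1]`, driven by `(Z, A)`: the
second-order expansion holds with a remainder `o(t - s)`, uniformly in `0 ≤ s < t ≤ 1`. -/
structure IsSolution {d d' : ℕ} (μ : (Fin d → ℝ) → Fin d → ℝ)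
    (σ : (Fin d → ℝ) → Fin d → Fin d' → ℝ) (Z : ℝ → Fin d' → ℝ)
    (A : ℝ → ℝ → Fin d' → Fin d' → ℝ) (x₀ : Fin d → ℝ) (X : ℝ → Fin d → ℝ) : Prop where
  initial : X 0 = x₀
  area : IsArea Z A
  expansion : ∀ ε > 0, ∃ δ > 0, ∀ s t : ℝ, 0 ≤ s → s < t → t ≤ 1 → t - s < δ → ∀ i,
    |X t i - X s i - increment μ σ Z A s t (X s) i| ≤ ε * (t - s)

/-- The mesh `Δ_n = 2^{-n}`. -/
def mesh (n : ℕ) : ℝ := 1 / 2 ^ n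

/-- The dyadic points `t_k^n = k / 2^n`. -/
def gridPoint (n k : ℕ) : ℝ := k / 2 ^ n

/-- The values `X^n(t_k^n)` of the scheme at the dyadic points. -/
def schemeGrid {d d' : ℕ} (μ : (Fin d → ℝ) → Fin d → ℝ)
    (σ : (Fin d → ℝ) → Fin d → Fin d' → ℝ) (Z : ℝ → Fin d' → ℝ)
    (A : ℝ → ℝ → Fin d' → Fin d' → ℝ) (x₀ : Fin d → ℝ) (n : ℕ) : ℕ → Fin d → ℝ
  | 0 => x₀
  | k + 1 => schemeGrid μ σ Z A x₀ n k
      + increment μ σ Z A (gridPoint n k) (gridPoint n (k + 1)) (schemeGrid μ σ Z A x₀ n k)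

/-- `X^n(t) = X^n(⌊t⌋)`, where `⌊t⌋` is the largest dyadic point of order `n` not above `t`. -/
def scheme {d d' : ℕ} (μ : (Fin d → ℝ) → Fin d → ℝ)
    (σ : (Fin d → ℝ) → Fin d → Fin d' → ℝ) (Z : ℝ → Fin d' → ℝ)
    (A : ℝ → ℝ → Fin d' → Fin d' → ℝ) (x₀ : Fin d → ℝ) (n : ℕ) (t : ℝ) : Fin d → ℝ :=
  schemeGrid μ σ Z A x₀ n ⌊2 ^ n * t⌋₊

/-! The explicit constants. Throughout `K` and `L` stand for (bounds on) `‖Z‖_α` and `‖A‖_{2α}`. -/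

/-- The constant of the three-point recursion for the second-order remainder of the scheme, given
constants `c₁`, `c₂` for the increments and for the first-order remainder. -/
def kappa (d d' : ℕ) (M K L c₁ c₂ : ℝ) : ℝ :=
  d * M * c₁ + d' * K * (d ^ 2 * M * c₁ ^ 2 + d * M * (c₂ + M)) + 2 * d ^ 2 * d' ^ 2 * M ^ 2 * L * c₁

/-- `C₁(δ)` -/
def locC1 (d d' : ℕ) (M K L : ℝ) : ℝ := 1 + M + d' * M * K + d * d' ^ 2 * M ^ 2 * L

/-- `C₂(δ)` -/
def locC2 (d d' : ℕ) (M L : ℝ) : ℝ := 1 + d * d' ^ 2 * M ^ 2 * L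

/-- `C₃(δ)` -/
def locC3 (d d' : ℕ) (α M K L : ℝ) : ℝ :=
  2 / (1 - 2 ^ (1 - 3 * α)) * kappa d d' M K L (locC1 d d' M K L) (locC2 d d' M L)

/-- `δ` -/
def delta (d d' : ℕ) (α M K L : ℝ) : ℝ := (2 + locC3 d d' α M K L) ^ (-(1 / α))

/-- `C₁` -/
def constC1 (d d' : ℕ) (α M K L : ℝ) : ℝ := 2 / delta d d' α M K L * locC1 d d' M K L

/-- `C₂` -/
def constC2 (d d' : ℕ) (α M K L : ℝ) : ℝ :=
  2 / delta d d' α M K L *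
    (locC2 d d' M L + d * M * constC1 d d' α M K L + d * d' * M * K * constC1 d d' α M K L)

/-- `C₃` -/
def constC3 (d d' : ℕ) (α M K L : ℝ) : ℝ :=
  2 / (1 - 2 ^ (1 - 3 * α)) *
    kappa d d' M K L (constC1 d d' α M K L) (constC2 d d' α M K L)

/-- `B₁(δ')` -/
def locB1 (d d' : ℕ) (M K L : ℝ) : ℝ :=
  1 + d * M + d * d' * M * K + 2 * d ^ 2 * d' ^ 2 * M ^ 2 * L

/-- `B₂(δ')` -/
def locB2 (d d' : ℕ) (M L : ℝ) : ℝ := 1 + d * M + 2 * d ^ 2 * d' ^ 2 * M ^ 2 * L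

/-- `B₃(δ')` -/
def locB3 (d d' : ℕ) (α M K L : ℝ) : ℝ :=
  2 / (1 - 2 ^ (1 - 3 * α)) *
    (d' * K * (d ^ 3 * M * constC1 d d' α M K L ^ 2
        + d ^ 2 * M * constC1 d d' α M K L * locB1 d d' M K L
        + d ^ 2 * M * (M + constC2 d d' α M K L) + d * M * locB2 d d' M L)
      + d' ^ 2 * L * (4 * d ^ 3 * M ^ 2 * constC1 d d' α M K L
        + 2 * d ^ 2 * M ^ 2 * locB1 d d' M K L))

/-- `δ'` -/
def delta' (d d' : ℕ) (α M K L : ℝ) : ℝ :=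
  (2 + 2 * locB1 d d' M K L + locB3 d d' α M K L) ^ (-(1 / α))

/-- `B` -/
def constB (d d' : ℕ) (α M K L : ℝ) : ℝ :=
  (2 + 2 * locB1 d d' M K L + locB3 d d' α M K L) * (1 + 2 ^ (2 / delta' d d' α M K L))

/-- `G₁ = (1 + B) C₃` -/
def constG1 (d d' : ℕ) (α M K L : ℝ) : ℝ :=
  (1 + constB d d' α M K L) * constC3 d d' α M K L

end

end RoughMilstein

namespace RoughMilstein

/-! Write ω for `span h k l ^ α`. The second-order increments fail to be additive only at order ω³:
Chen's relation turns the cross term of the area into the first-order Taylor term of `σ`, and what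
remains is cubic (`gridIncrement_three_point`). Since 3α > 1, `grid_sewing` sums such defects with a
constant independent of the number of cells.

The a priori bounds come from a bootstrap. The defect estimate presupposes bounds on the increments;
these hold once the remainder is at most ω² on shorter intervals, which the sewing induction
supplies on windows of length `delta` (`local_remainder_le_sq`). Chaining windows gives
`norm_sub_le` and `firstRemainder_le` on all of [0,1], and a second sewing with these global
constants gives `remainder_le`. A solution has one-step remainders o(h), so refining the grid leaves
it with the remainder C₃(t-s)^(3α) (`IsSolution.norm_remainder_le`).

Sewing the difference of two runs of the scheme, which uses the third derivatives of `σ`, shows that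
this difference at most doubles over a window of length `delta'`. Hence, for small mesh, the scheme
is Lipschitz in its initial value with the mesh-independent constant 2^(2/δ')
(`norm_sub_scheme_le`). Restarting the scheme from the solution at every grid point and telescoping,
2^n local errors of size C₃Δ^(3α) add up to order Δ^(3α-1) (`norm_flow_sub_le`). Between grid points
the solution moves by O(Δ^α), which is of smaller order because α < 1/2. -/

/-- The partial derivative `∂_l f`. -/
noncomputable def pd {d : ℕ} (l : Fin d) (f : (Fin d → ℝ) → ℝ) (x : Fin d → ℝ) : ℝ :=
  fderiv ℝ f x (Pi.single l 1)

/-- `f` is `k` times differentiable, and it and its partial derivatives up to order `k` are bounded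
by `M`. -/
def BoundedDeriv {d : ℕ} (M : ℝ) : ℕ → ((Fin d → ℝ) → ℝ) → Prop
  | 0, f => ∀ x, |f x| ≤ M
  | k + 1, f => (∀ x, |f x| ≤ M) ∧ Differentiable ℝ f ∧ ∀ l, BoundedDeriv M k (pd l f)

/-! ### Mean value and Taylor estimates with explicit constants -/

section Analysis

variable {d d' : ℕ} {M : ℝ}

theorem BoundedDeriv.abs_le {k : ℕ} {f : (Fin d → ℝ) → ℝ} (hf : BoundedDeriv M k f)
    (x : Fin d → ℝ) : |f x| ≤ M := by
  cases k with
  | zero => exact hf x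
  | succ k => exact hf.1 x

theorem BoundedDeriv.mono_succ {k : ℕ} {f : (Fin d → ℝ) → ℝ} (hf : BoundedDeriv M (k + 1) f) :
    BoundedDeriv M k f := by
  induction k generalizing f with
  | zero => exact hf.1
  | succ k ih => exact ⟨hf.1, hf.2.1, fun l => ih (hf.2.2 l)⟩

theorem fderiv_apply_eq_sum (f : (Fin d → ℝ) → ℝ) (x v : Fin d → ℝ) :
    fderiv ℝ f x v = ∑ l, pd l f x * v l := by
  conv_lhs => rw [pi_eq_sum_univ' v]
  rw [map_sum]
  refine Finset.sum_congr rfl fun l _ => ?_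
  rw [map_smul, smul_eq_mul, mul_comm, pd]

theorem abs_sum_mul_le {g v : Fin d → ℝ} {P V : ℝ} (hP : ∀ l, |g l| ≤ P) (hP0 : 0 ≤ P)
    (hv : ∀ l, |v l| ≤ V) : |∑ l, g l * v l| ≤ d * (P * V) := by
  refine (Finset.abs_sum_le_sum_abs _ _).trans ?_
  refine (Finset.sum_le_card_nsmul _ _ (P * V) fun l _ => ?_).trans (by simp)
  rw [abs_mul]
  exact mul_le_mul (hP l) (hv l) (abs_nonneg _) hP0

theorem abs_apply_le_norm (v : Fin d → ℝ) (l : Fin d) : |v l| ≤ ‖v‖ := norm_le_pi_norm v l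

theorem hasDerivAt_line {f : (Fin d → ℝ) → ℝ} (hf : Differentiable ℝ f) (x u : Fin d → ℝ) (θ : ℝ) :
    HasDerivAt (fun θ : ℝ => f (x + θ • u)) (∑ l, pd l f (x + θ • u) * u l) θ := by
  rw [← fderiv_apply_eq_sum]
  have h1 : HasDerivAt (fun θ : ℝ => x + θ • u) u θ := by
    simpa using ((hasDerivAt_id θ).smul_const u).const_add x
  exact (hf (x + θ • u)).hasFDerivAt.comp_hasDerivAt θ h1

theorem norm_line_sub_le {x u x' u' : Fin d → ℝ} {S θ : ℝ} (hS : ‖x - x'‖ ≤ S)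
    (hS' : ‖x + u - (x' + u')‖ ≤ S) (h0 : 0 ≤ θ) (h1 : θ ≤ 1) :
    ‖x + θ • u - (x' + θ • u')‖ ≤ S := by
  have : x + θ • u - (x' + θ • u') = (1 - θ) • (x - x') + θ • (x + u - (x' + u')) := by
    module
  rw [this]
  refine (norm_add_le _ _).trans ?_
  rw [norm_smul, norm_smul, Real.norm_of_nonneg h0, Real.norm_of_nonneg (sub_nonneg.2 h1)]
  nlinarith [mul_le_mul_of_nonneg_left hS (sub_nonneg.2 h1), mul_le_mul_of_nonneg_left hS' h0]

/-- The mean value theorem is applied once, to θ ↦ f(x+θu) - f(x'+θu'), so both gradients are taken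
at the same θ. Their difference is then controlled by the distance of the two segments, which
convexity of the norm bounds by `S`. -/
theorem abs_double_sub_le {f : (Fin d → ℝ) → ℝ} {P Λ S : ℝ} (hf : Differentiable ℝ f)
    (hP0 : 0 ≤ P) (hΛ0 : 0 ≤ Λ)
    (hP : ∀ l x, |pd l f x| ≤ P) (hΛ : ∀ l x x', |pd l f x - pd l f x'| ≤ Λ * ‖x - x'‖)
    {x u x' u' : Fin d → ℝ} (hS : ‖x - x'‖ ≤ S) (hS' : ‖x + u - (x' + u')‖ ≤ S) :
    |f (x + u) - f x - (f (x' + u') - f x')| ≤ d * (Λ * S * ‖u‖ + P * ‖u - u'‖) := by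
  have hS0 : 0 ≤ S := (norm_nonneg _).trans hS
  obtain ⟨θ, hθ, h⟩ := exists_hasDerivAt_eq_slope
    (fun θ : ℝ => f (x + θ • u) - f (x' + θ • u'))
    (fun θ => ∑ l, pd l f (x + θ • u) * u l - ∑ l, pd l f (x' + θ • u') * u' l)
    one_pos
    (fun θ _ => ((hasDerivAt_line hf x u θ).sub
      (hasDerivAt_line hf x' u' θ)).continuousAt.continuousWithinAt)
    (fun θ _ => (hasDerivAt_line hf x u θ).sub (hasDerivAt_line hf x' u' θ))
  simp only [one_smul, zero_smul, add_zero, sub_zero, div_one] at h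
  have e : f (x + u) - f x - (f (x' + u') - f x')
      = ∑ l, (pd l f (x + θ • u) - pd l f (x' + θ • u')) * u l
        + ∑ l, pd l f (x' + θ • u') * (u - u') l := by
    rw [← Finset.sum_add_distrib]
    calc _ = f (x + u) - f (x' + u') - (f x - f x') := by ring
      _ = _ := by
        rw [← h, ← Finset.sum_sub_distrib]
        refine Finset.sum_congr rfl fun l _ => ?_
        simp only [Pi.sub_apply]; ring
  rw [e]
  have hl := norm_line_sub_le hS hS' hθ.1.le hθ.2.le
  have h1 := abs_sum_mul_le (g := fun l => pd l f (x + θ • u) - pd l f (x' + θ • u')) (v := u)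
    (P := Λ * S) (V := ‖u‖) (fun l => (hΛ l _ _).trans (mul_le_mul_of_nonneg_left hl hΛ0))
    (mul_nonneg hΛ0 hS0) (abs_apply_le_norm u)
  have h2 := abs_sum_mul_le (g := fun l => pd l f (x' + θ • u')) (v := u - u')
    (fun l => hP l _) hP0 (abs_apply_le_norm _)
  refine (abs_add_le _ _).trans ((add_le_add h1 h2).trans_eq (by ring))

theorem BoundedDeriv.abs_sub_le {k : ℕ} {f : (Fin d → ℝ) → ℝ} (hM : 0 ≤ M)
    (hf : BoundedDeriv M (k + 1) f) (x y : Fin d → ℝ) : |f x - f y| ≤ d * M * ‖x - y‖ := by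
  obtain ⟨θ, hθ, h⟩ := exists_hasDerivAt_eq_slope
    (fun θ : ℝ => f (y + θ • (x - y))) (fun θ => ∑ l, pd l f (y + θ • (x - y)) * (x - y) l)
    one_pos (fun θ _ => (hasDerivAt_line hf.2.1 _ _ θ).continuousAt.continuousWithinAt)
    (fun θ _ => hasDerivAt_line hf.2.1 _ _ θ)
  simp only [one_smul, zero_smul, add_zero, sub_zero, div_one, add_sub_cancel] at h
  rw [← h, mul_assoc]
  exact abs_sum_mul_le (fun l => (hf.2.2 l).abs_le _) hM (abs_apply_le_norm _)

theorem BoundedDeriv.abs_taylor_le {k : ℕ} {f : (Fin d → ℝ) → ℝ} (hM : 0 ≤ M)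
    (hf : BoundedDeriv M (k + 2) f) (x u : Fin d → ℝ) :
    |f (x + u) - f x - ∑ l, pd l f x * u l| ≤ d ^ 2 * M * ‖u‖ ^ 2 := by
  obtain ⟨θ, hθ, h⟩ := exists_hasDerivAt_eq_slope
    (fun θ : ℝ => f (x + θ • u)) (fun θ => ∑ l, pd l f (x + θ • u) * u l)
    one_pos (fun θ _ => (hasDerivAt_line hf.2.1 _ _ θ).continuousAt.continuousWithinAt)
    (fun θ _ => hasDerivAt_line hf.2.1 _ _ θ)
  simp only [one_smul, zero_smul, add_zero, sub_zero, div_one] at h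
  rw [← h, ← Finset.sum_sub_distrib]
  simp_rw [← sub_mul]
  refine (abs_sum_mul_le (P := d * M * ‖u‖) (fun l => ?_) (by positivity)
    (abs_apply_le_norm _)).trans_eq (by ring)
  refine ((hf.2.2 l).abs_sub_le hM _ _).trans ?_
  rw [add_sub_cancel_left, norm_smul, Real.norm_of_nonneg hθ.1.le]
  exact mul_le_mul_of_nonneg_left (mul_le_of_le_one_left (norm_nonneg _) hθ.2.le) (by positivity)

/-- Integrating the linear bound gains the factor 1/2 that a mean value argument would lose;
`BoundedDeriv.abs_taylor_sub_le` needs it to reach its constant. -/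
theorem abs_sub_le_half_of_abs_deriv_le {φ φ' : ℝ → ℝ} {Q : ℝ} (hφ : ∀ θ, HasDerivAt φ (φ' θ) θ)
    (h : ∀ θ, 0 ≤ θ → θ ≤ 1 → |φ' θ| ≤ Q * θ) : |φ 1 - φ 0| ≤ Q / 2 := by
  have := image_norm_le_of_norm_deriv_right_le_deriv_boundary (a := (0 : ℝ)) (b := 1)
    (f := fun θ => φ θ - φ 0) (f' := φ') (B := fun θ => Q * θ ^ 2 / 2) (B' := fun θ => Q * θ)
    (fun θ _ => ((hφ θ).sub_const _).continuousAt.continuousWithinAt)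
    (fun θ _ => ((hφ θ).sub_const _).hasDerivWithinAt) (by simp)
    (fun θ => by
      have e : (fun θ : ℝ => Q * θ ^ 2 / 2) = fun θ => Q / 2 * θ ^ 2 := by funext t; ring
      rw [e]
      exact ((hasDerivAt_pow 2 θ).const_mul (Q / 2)).congr_deriv (by norm_num; ring))
    (fun θ hθ => h θ hθ.1 hθ.2.le) (x := 1) (by simp)
  simpa using this

/-- Along the two segments the θ-derivative of the difference of remainders vanishes at θ = 0 and
grows linearly, by the double-difference bound for each ∂_l f; this is where third derivatives
enter. The term in `V` arises twice, and the 1/2 from integration cancels this. -/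
theorem BoundedDeriv.abs_taylor_sub_le {k : ℕ} {f : (Fin d → ℝ) → ℝ} (hM : 0 ≤ M)
    (hf : BoundedDeriv M (k + 3) f) {x u x' u' : Fin d → ℝ} {S U V : ℝ} (hS : ‖x - x'‖ ≤ S)
    (hS' : ‖x + u - (x' + u')‖ ≤ S) (hu : ‖u‖ ≤ U) (hu' : ‖u'‖ ≤ U) (hV : ‖u - u'‖ ≤ V) :
    |f (x + u) - f x - ∑ l, pd l f x * u l - (f (x' + u') - f x' - ∑ l, pd l f x' * u' l)|
      ≤ d ^ 3 * M * U ^ 2 * S + d ^ 2 * M * U * V := by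
  have hS0 : 0 ≤ S := (norm_nonneg _).trans hS
  have hU0 : 0 ≤ U := (norm_nonneg _).trans hu
  have hV0 : 0 ≤ V := (norm_nonneg _).trans hV
  have key := abs_sub_le_half_of_abs_deriv_le (Q := d ^ 3 * M * U ^ 2 * S + 2 * (d ^ 2 * M * U * V))
    (φ := fun θ => f (x + θ • u) - θ * ∑ l, pd l f x * u l
      - (f (x' + θ • u') - θ * ∑ l, pd l f x' * u' l))
    (fun θ => ((hasDerivAt_line hf.2.1 x u θ).sub ((hasDerivAt_id θ).mul_const _)).sub
      ((hasDerivAt_line hf.2.1 x' u' θ).sub ((hasDerivAt_id θ).mul_const _)))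
    (fun θ h0 h1 => by
      have hl := norm_line_sub_le hS hS' h0 h1
      have e : ∑ l, pd l f (x + θ • u) * u l - 1 * ∑ l, pd l f x * u l
          - (∑ l, pd l f (x' + θ • u') * u' l - 1 * ∑ l, pd l f x' * u' l)
          = ∑ l, (pd l f (x + θ • u) - pd l f x - (pd l f (x' + θ • u') - pd l f x')) * u l
            + ∑ l, (pd l f (x' + θ • u') - pd l f x') * (u - u') l := by
        simp only [one_mul, ← Finset.sum_sub_distrib, ← Finset.sum_add_distrib]
        refine Finset.sum_congr rfl fun l _ => ?_
        simp only [Pi.sub_apply]; ring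
      rw [e]
      have hn : ∀ v : Fin d → ℝ, ‖θ • v‖ = θ * ‖v‖ := fun v => by
        rw [norm_smul, Real.norm_of_nonneg h0]
      have h2 := abs_sum_mul_le
        (g := fun l => pd l f (x + θ • u) - pd l f x - (pd l f (x' + θ • u') - pd l f x')) (v := u)
        (P := d * (d * M * S * (θ * U) + M * (θ * V))) (V := U)
        (fun l => by
          have hg := hf.2.2 l
          refine (abs_double_sub_le (P := M) (Λ := d * M) (S := S) hg.2.1 hM (by positivity)
            (fun p => (hg.2.2 p).abs_le) (fun p => (hg.2.2 p).abs_sub_le hM) hS hl).trans ?_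
          rw [← smul_sub, hn, hn]
          gcongr)
        (by positivity) (fun l => (abs_apply_le_norm u l).trans hu)
      have h3 := abs_sum_mul_le
        (g := fun l => pd l f (x' + θ • u') - pd l f x') (v := u - u')
        (P := d * M * (θ * U)) (V := V)
        (fun l => by
          refine ((hf.2.2 l).abs_sub_le hM _ _).trans ?_
          rw [add_sub_cancel_left, hn]
          gcongr)
        (by positivity) (fun l => (abs_apply_le_norm _ l).trans hV)
      exact (abs_add_le _ _).trans ((add_le_add h2 h3).trans_eq (by ring)))
  simp only [one_smul, zero_smul, add_zero, one_mul, zero_mul, sub_zero] at key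
  have hnn : 0 ≤ d ^ 3 * M * U ^ 2 * S := by positivity
  calc _ = |f (x + u) - ∑ l, pd l f x * u l - (f (x' + u') - ∑ l, pd l f x' * u' l)
        - (f x - f x')| := by congr 1; ring
    _ ≤ _ := key.trans (by linarith)

theorem pd_mul {f g : (Fin d → ℝ) → ℝ} (hf : Differentiable ℝ f) (hg : Differentiable ℝ g)
    (l : Fin d) (x : Fin d → ℝ) :
    pd l (fun x => f x * g x) x = f x * pd l g x + g x * pd l f x := by
  simp [pd, fderiv_fun_mul (hf x) (hg x)]

theorem abs_mul_sub_mul_le {a b a' b' P Q R T : ℝ} (ha' : |a'| ≤ P) (hb : |b| ≤ Q)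
    (h1 : |a - a'| ≤ R) (h2 : |b - b'| ≤ T) : |a * b - a' * b'| ≤ R * Q + P * T := by
  have : a * b - a' * b' = (a - a') * b + a' * (b - b') := by ring
  rw [this]
  refine (abs_add_le _ _).trans ?_
  rw [abs_mul, abs_mul]
  exact add_le_add (mul_le_mul h1 hb (abs_nonneg _) ((abs_nonneg _).trans h1))
    (mul_le_mul ha' h2 (abs_nonneg _) ((abs_nonneg _).trans ha'))

/-- The product has gradient components bounded by 2M² with Lipschitz constant 4dM², so the
double-difference bound applies to it. It is meant for the products ∂σ·σ that multiply the areas. -/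
theorem BoundedDeriv.abs_mul_double_sub_le {k : ℕ} {f g : (Fin d → ℝ) → ℝ} (hM : 0 ≤ M)
    (hf : BoundedDeriv M (k + 2) f) (hg : BoundedDeriv M (k + 2) g)
    {x u x' u' : Fin d → ℝ} {S U V : ℝ} (hS : ‖x - x'‖ ≤ S)
    (hS' : ‖x + u - (x' + u')‖ ≤ S) (hu : ‖u‖ ≤ U) (hV : ‖u - u'‖ ≤ V) :
    |f (x + u) * g (x + u) - f x * g x - (f (x' + u') * g (x' + u') - f x' * g x')|
      ≤ 4 * d ^ 2 * M ^ 2 * U * S + 2 * d * M ^ 2 * V := by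
  have hS0 : 0 ≤ S := (norm_nonneg _).trans hS
  refine (abs_double_sub_le (f := fun x => f x * g x) (P := 2 * M ^ 2) (Λ := 4 * d * M ^ 2)
    (hf.2.1.mul hg.2.1) (by positivity) (by positivity) (fun l y => ?_) (fun l y y' => ?_)
    hS hS').trans ?_
  · rw [pd_mul hf.2.1 hg.2.1]
    refine (abs_add_le _ _).trans ?_
    rw [abs_mul, abs_mul]
    have h1 := mul_le_mul (hf.abs_le y) ((hg.2.2 l).abs_le y) (abs_nonneg _) hM
    have h2 := mul_le_mul (hg.abs_le y) ((hf.2.2 l).abs_le y) (abs_nonneg _) hM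
    linarith [sq M]
  · rw [pd_mul hf.2.1 hg.2.1, pd_mul hf.2.1 hg.2.1]
    have hf1 : BoundedDeriv M (k + 1 + 1) f := hf
    have hg1 : BoundedDeriv M (k + 1 + 1) g := hg
    have h1 := abs_mul_sub_mul_le (hf.abs_le y') ((hg.2.2 l).abs_le y) (hf1.abs_sub_le hM y y')
      ((hg.2.2 l).abs_sub_le hM y y')
    have h2 := abs_mul_sub_mul_le (hg.abs_le y') ((hf.2.2 l).abs_le y) (hg1.abs_sub_le hM y y')
      ((hf.2.2 l).abs_sub_le hM y y')
    rw [add_sub_add_comm]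
    exact (abs_add_le _ _).trans ((add_le_add h1 h2).trans_eq (by ring))
  · calc (d : ℝ) * (4 * d * M ^ 2 * S * ‖u‖ + 2 * M ^ 2 * ‖u - u'‖)
        ≤ d * (4 * d * M ^ 2 * S * U + 2 * M ^ 2 * V) := by gcongr
      _ = _ := by ring

/-! ### Coordinatewise form of the coefficient bounds -/

section Coefficients

variable {μ : (Fin d → ℝ) → Fin d → ℝ} {σ : (Fin d → ℝ) → Fin d → Fin d' → ℝ}

theorem CoeffBounds.boundedDeriv_drift (h : CoeffBounds μ σ M) (i : Fin d) :
    BoundedDeriv M 1 (fun x => μ x i) := by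
  refine ⟨fun x => h.drift_le x i, fun x => differentiableAt_pi.1 (h.differentiable_drift x) i,
    fun l x => ?_⟩
  rw [pd, fderiv_apply (h.differentiable_drift x)]
  exact h.fderiv_drift_le x l i

/-- Evaluation at fixed basis vectors and a fixed component is continuous linear, so it commutes
with `fderiv`; differentiating in direction `p` prepends `p` to the list of directions. The
induction is on the number `m` of derivatives still available. -/
theorem CoeffBounds.boundedDeriv_iteratedFDeriv (h : CoeffBounds μ σ M) (i : Fin d) (j : Fin d')
    (m : ℕ) : ∀ k, k + m = 3 → ∀ l : Fin k → Fin d,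
    BoundedDeriv M m (fun x => iteratedFDeriv ℝ k σ x (fun a => Pi.single (l a) 1) i j) := by
  induction m with
  | zero => exact fun k hk l x => h.diffusion_le k (by omega) x l i j
  | succ m ih =>
    intro k hk l
    have hd := h.differentiable_diffusion k (by omega)
    have key : ∀ x, HasFDerivAt
        (fun x => iteratedFDeriv ℝ k σ x (fun a => Pi.single (l a) 1) i j)
        (((ContinuousLinearMap.proj j).comp (ContinuousLinearMap.proj i)).comp
          ((ContinuousMultilinearMap.apply ℝ (fun _ : Fin k => Fin d → ℝ) (Fin d → Fin d' → ℝ)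
            (fun a => Pi.single (l a) 1)).comp (fderiv ℝ (iteratedFDeriv ℝ k σ) x))) x := by
      intro x
      exact ((ContinuousLinearMap.proj (R := ℝ) (φ := fun _ : Fin d' => ℝ) j).comp
        (ContinuousLinearMap.proj (R := ℝ) (φ := fun _ : Fin d => Fin d' → ℝ) i)).hasFDerivAt.comp x
        ((ContinuousMultilinearMap.apply ℝ (fun _ : Fin k => Fin d → ℝ) (Fin d → Fin d' → ℝ)
            (fun a => Pi.single (l a) 1)).hasFDerivAt.comp x (hd x).hasFDerivAt)
    refine ⟨fun x => h.diffusion_le k (by omega) x l i j, fun x => (key x).differentiableAt,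
      fun p => ?_⟩
    convert ih (k + 1) (by omega) (Fin.cons p l) using 1
    ext x
    rw [pd, (key x).fderiv, iteratedFDeriv_succ_apply_left]
    rfl

theorem CoeffBounds.boundedDeriv_diffusion (h : CoeffBounds μ σ M) (i : Fin d) (j : Fin d') :
    BoundedDeriv M 3 (fun x => σ x i j) := by
  simpa using h.boundedDeriv_iteratedFDeriv i j 3 0 rfl Fin.elim0

theorem CoeffBounds.pd_diffusion (h : CoeffBounds μ σ M) (l i : Fin d) (j : Fin d') :
    partialDeriv σ l i j = pd l (fun x => σ x i j) := by
  have hd : Differentiable ℝ σ := by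
    have := h.differentiable_diffusion 0 (by norm_num)
    have e : σ = fun x => iteratedFDeriv ℝ 0 σ x Fin.elim0 := by ext; simp
    rw [e]
    exact fun x => (ContinuousMultilinearMap.apply ℝ (fun _ : Fin 0 => Fin d → ℝ)
      (Fin d → Fin d' → ℝ) Fin.elim0).differentiableAt.comp x (this x)
  ext x
  have h1 : DifferentiableAt ℝ (fun x => σ x i) x := differentiableAt_pi.1 (hd x) i
  rw [pd, fderiv_apply h1, fderiv_apply (hd x)]
  rfl

end Coefficients

end Analysis

/-! ### Grid intervals and discrete sewing -/

/-- The length of the interval between the grid points with indices `k` and `l`. -/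
noncomputable def span (h : ℝ) (k l : ℕ) : ℝ := ((l : ℝ) - k) * h

section Span

variable {h : ℝ} {k m l k' l' : ℕ}

@[simp] theorem span_self : span h k k = 0 := by simp [span]

theorem span_succ : span h k (k + 1) = h := by simp [span]

theorem span_add_span (h : ℝ) (k m l : ℕ) : span h k m + span h m l = span h k l := by
  simp only [span]; ring

theorem span_nonneg (hh : 0 ≤ h) (hkl : k ≤ l) : 0 ≤ span h k l :=
  mul_nonneg (sub_nonneg.2 (Nat.cast_le.2 hkl)) hh

theorem span_mono (hh : 0 ≤ h) (hk : k ≤ k') (hl : l' ≤ l) : span h k' l' ≤ span h k l := by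
  have h1 : (k : ℝ) ≤ k' := Nat.cast_le.2 hk
  have h2 : (l' : ℝ) ≤ l := Nat.cast_le.2 hl
  exact mul_le_mul_of_nonneg_right (by linarith) hh

theorem span_shift (h : ℝ) (p k l : ℕ) : span h (p + k) (p + l) = span h k l := by
  simp [span]

end Span

theorem two_mul_rpow_cube_le {α x y : ℝ} (hα : 0 ≤ α) (hx : 0 ≤ x) (hxy : x ≤ y / 2) :
    2 * (x ^ α) ^ 3 ≤ 2 ^ (1 - 3 * α) * (y ^ α) ^ 3 := by
  have hy : 0 ≤ y := by linarith
  have h1 : x ^ α ≤ y ^ α / 2 ^ α := by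
    rw [← Real.div_rpow hy zero_le_two]
    exact Real.rpow_le_rpow hx hxy hα
  have h2 : (2 : ℝ) ^ (1 - 3 * α) = 2 / (2 ^ α) ^ 3 := by
    rw [Real.rpow_sub two_pos, Real.rpow_one, mul_comm, Real.rpow_mul zero_le_two]
    norm_cast
  calc 2 * (x ^ α) ^ 3 ≤ 2 * (y ^ α / 2 ^ α) ^ 3 := by
        have := Real.rpow_nonneg hx α
        gcongr
    _ = _ := by rw [h2, div_pow]; ring

/-- Sewing on a uniform grid, by splitting at the two grid points next to the middle. -/
theorem grid_sewing {α h c κ ε δ : ℝ} {N : ℕ} {E : ℕ → ℕ → ℝ} (hα : 0 ≤ α) (hh : 0 ≤ h)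
    (hc : 0 ≤ c) (hκ : 0 ≤ κ) (hcκ : 2 * κ ≤ (1 - 2 ^ (1 - 3 * α)) * c)
    (hdiag : ∀ k ≤ N, E k k ≤ 0) (hadj : ∀ k < N, E k (k + 1) ≤ ε * h)
    (hsplit : ∀ k m l, k < m → m < l → l ≤ N → span h k l ≤ δ →
      (∀ k' l', k ≤ k' → k' ≤ l' → l' ≤ l → l' - k' < l - k →
        E k' l' ≤ c * (span h k' l' ^ α) ^ 3 + ε * span h k' l') →
      E k l ≤ E k m + E m l + κ * (span h k l ^ α) ^ 3)
    {k l : ℕ} (hkl : k ≤ l) (hlN : l ≤ N) (hδ : span h k l ≤ δ) :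
    E k l ≤ c * (span h k l ^ α) ^ 3 + ε * span h k l := by
  induction hn : l - k using Nat.strong_induction_on generalizing k l with
  | _ n ih =>
  subst hn
  have IH : ∀ k' l', k ≤ k' → k' ≤ l' → l' ≤ l → l' - k' < l - k →
      E k' l' ≤ c * (span h k' l' ^ α) ^ 3 + ε * span h k' l' := fun k' l' h1 h2 h3 h4 =>
    ih _ h4 h2 (h3.trans hlN) ((span_mono hh h1 h3).trans hδ) rfl
  have hω : ∀ k' l', k' ≤ l' → 0 ≤ span h k' l' ^ α := fun k' l' h' =>
    Real.rpow_nonneg (span_nonneg hh h') α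
  have hωm : ∀ k' l', k ≤ k' → k' ≤ l' → l' ≤ l → span h k' l' ^ α ≤ span h k l ^ α :=
    fun k' l' h1 h2 h3 => Real.rpow_le_rpow (span_nonneg hh h2) (span_mono hh h1 h3) hα
  -- Two pieces of at most half the length contribute together a fraction 2^(1-3α) of the target;
  -- the rest pays for two applications of `hsplit`, whence the 2κ in `hcκ`.
  have half : ∀ k' l', k' ≤ l' → 2 * (l' - k') ≤ l - k →
      2 * (c * (span h k' l' ^ α) ^ 3) ≤ 2 ^ (1 - 3 * α) * c * (span h k l ^ α) ^ 3 := by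
    intro k' l' h1 h2
    have : span h k' l' ≤ span h k l / 2 := by
      have h3 : ((2 * (l' - k') : ℕ) : ℝ) ≤ ((l - k : ℕ) : ℝ) := Nat.cast_le.2 h2
      push_cast [Nat.cast_sub h1, Nat.cast_sub hkl] at h3
      have := mul_le_mul_of_nonneg_right h3 hh
      simp only [span]; linarith
    have := mul_le_mul_of_nonneg_left
      (two_mul_rpow_cube_le hα (span_nonneg hh h1) this) hc
    linarith
  have hκ' : 2 * (κ * (span h k l ^ α) ^ 3)
      ≤ (1 - 2 ^ (1 - 3 * α)) * c * (span h k l ^ α) ^ 3 := by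
    have := mul_le_mul_of_nonneg_right hcκ (pow_nonneg (hω k l hkl) 3)
    linarith
  obtain rfl | h1 := hkl.eq_or_lt
  · refine (hdiag k hlN).trans ?_
    rw [span_self, mul_zero, add_zero]
    have := hω k k le_rfl
    rw [span_self] at this
    positivity
  obtain rfl | h2 := (Nat.succ_le_of_lt h1).eq_or_lt
  · have := hadj k hlN
    rw [Nat.succ_eq_add_one, span_succ]
    have := Real.rpow_nonneg hh α
    have : 0 ≤ c * (h ^ α) ^ 3 := by positivity
    linarith
  -- With the rounded-down midpoint, both [k,m] and [m+1,l] have at most half the length. The cell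
  -- [m,m+1] between them is charged to `ε` alone.
  obtain ⟨m, hm⟩ : ∃ m, m = (k + l) / 2 := ⟨_, rfl⟩
  have hkm : k < m := by omega
  have hml : m < l := by omega
  have s1 := hsplit k m l hkm hml hlN hδ IH
  have e1 := IH k m le_rfl hkm.le hml.le (by omega)
  have f1 := half k m hkm.le (by omega)
  have w1 : ε * span h k m + ε * span h m l = ε * span h k l := by rw [← mul_add, span_add_span]
  have hκ0 : 0 ≤ κ * (span h k l ^ α) ^ 3 := mul_nonneg hκ (pow_nonneg (hω k l hkl) 3)
  -- If m+1 = l there are just two cells, both halves are short enough, and a single split suffices.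
  obtain h3 | h3 := (Nat.succ_le_of_lt hml).eq_or_lt
  · have e2 := IH m l hkm.le hml.le le_rfl (by omega)
    have f2 := half m l hml.le (by omega)
    linarith
  · have s2 := hsplit m (m + 1) l (by omega) h3 hlN ((span_mono hh hkm.le le_rfl).trans hδ)
      (fun k' l' g1 g2 g3 g4 => IH k' l' (hkm.le.trans g1) g2 g3 (by omega))
    have e2 := hadj m (by omega)
    have e3 := IH (m + 1) l (by omega) (by omega) le_rfl (by omega)
    have f3 := half (m + 1) l (by omega) (by omega)
    have g : κ * (span h m l ^ α) ^ 3 ≤ κ * (span h k l ^ α) ^ 3 := by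
      have := hωm m l hkm.le hml.le le_rfl
      have := hω m l hml.le
      gcongr
    have w2 : ε * h + ε * span h (m + 1) l = ε * span h m l := by
      rw [← span_add_span h m (m + 1) l, span_succ, mul_add]
    linarith

/-! ### Drivers sampled on a grid -/

/-- The driving path and its area, sampled along a uniform grid of `N` intervals of length `h`. -/
structure GridDriver {d' : ℕ} (α h K L : ℝ) (N : ℕ) (z : ℕ → Fin d' → ℝ)
    (a : ℕ → ℕ → Fin d' → Fin d' → ℝ) : Prop where
  pos : 0 < h
  le_one : N * h ≤ 1
  chen : ∀ k m l, k ≤ m → m ≤ l → l ≤ N → ∀ i j,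
    a k l i j = a k m i j + a m l i j + (z m i - z k i) * (z l j - z m j)
  path_le : ∀ k l, k ≤ l → l ≤ N → ∀ i, |z l i - z k i| ≤ K * span h k l ^ α
  area_le : ∀ k l, k ≤ l → l ≤ N → ∀ i j, |a k l i j| ≤ L * (span h k l ^ α) ^ 2

/-- The first-order increment driven by the path. -/
def linearTerm {d d' : ℕ} (σ : (Fin d → ℝ) → Fin d → Fin d' → ℝ) (z : ℕ → Fin d' → ℝ)
    (k l : ℕ) (x : Fin d → ℝ) : Fin d → ℝ := fun i => ∑ j, σ x i j * (z l j - z k j)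

/-- The second-order increment driven by the area. -/
noncomputable def areaTerm {d d' : ℕ} (σ : (Fin d → ℝ) → Fin d → Fin d' → ℝ)
    (a : ℕ → ℕ → Fin d' → Fin d' → ℝ) (k l : ℕ) (x : Fin d → ℝ) : Fin d → ℝ := fun i =>
  ∑ j, ∑ p, ∑ q, partialDeriv σ p i j x * σ x p q * a k l q j

/-- The part of the second-order increment that does not involve the drift. -/
noncomputable def noise {d d' : ℕ} (σ : (Fin d → ℝ) → Fin d → Fin d' → ℝ) (z : ℕ → Fin d' → ℝ)
    (a : ℕ → ℕ → Fin d' → Fin d' → ℝ) (k l : ℕ) (x : Fin d → ℝ) : Fin d → ℝ :=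
  linearTerm σ z k l x + areaTerm σ a k l x

/-- The second-order increment between two grid points. -/
noncomputable def gridIncrement {d d' : ℕ} (μ : (Fin d → ℝ) → Fin d → ℝ)
    (σ : (Fin d → ℝ) → Fin d → Fin d' → ℝ) (z : ℕ → Fin d' → ℝ)
    (a : ℕ → ℕ → Fin d' → Fin d' → ℝ) (h : ℝ) (k l : ℕ) (x : Fin d → ℝ) : Fin d → ℝ :=
  span h k l • μ x + noise σ z a k l x

section Driver

variable {d d' N : ℕ} {α h K L M : ℝ} {z : ℕ → Fin d' → ℝ} {a : ℕ → ℕ → Fin d' → Fin d' → ℝ}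

theorem GridDriver.shift (hD : GridDriver α h K L N z a) (p : ℕ) (hp : p ≤ N) :
    GridDriver α h K L (N - p) (fun k => z (p + k)) (fun k l => a (p + k) (p + l)) where
  pos := hD.pos
  le_one := (mul_le_mul_of_nonneg_right (Nat.cast_le.2 (Nat.sub_le N p)) hD.pos.le).trans hD.le_one
  chen k m l h1 h2 h3 := hD.chen _ _ _ (by omega) (by omega) (by omega)
  path_le k l h1 h2 i := by
    rw [← span_shift h p]; exact hD.path_le _ _ (by omega) (by omega) i
  area_le k l h1 h2 i j := by
    rw [← span_shift h p]; exact hD.area_le _ _ (by omega) (by omega) i j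

theorem GridDriver.span_le_one (hD : GridDriver α h K L N z a) {k l : ℕ} (hl : l ≤ N) :
    span h k l ≤ 1 := by
  refine le_trans ?_ hD.le_one
  refine mul_le_mul_of_nonneg_right ?_ hD.pos.le
  have h1 : (l : ℝ) ≤ N := Nat.cast_le.2 hl
  linarith [Nat.cast_nonneg (α := ℝ) k]

theorem GridDriver.rpow_nonneg (hD : GridDriver α h K L N z a) {k l : ℕ} (hkl : k ≤ l) :
    0 ≤ span h k l ^ α := Real.rpow_nonneg (span_nonneg hD.pos.le hkl) α

theorem GridDriver.rpow_le_one (hD : GridDriver α h K L N z a) (hα : 0 ≤ α) {k l : ℕ} (hkl : k ≤ l)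
    (hl : l ≤ N) : span h k l ^ α ≤ 1 :=
  Real.rpow_le_one (span_nonneg hD.pos.le hkl) (hD.span_le_one hl) hα

theorem GridDriver.rpow_mono (hD : GridDriver α h K L N z a) (hα : 0 ≤ α) {k k' l' l : ℕ}
    (h1 : k ≤ k') (h2 : k' ≤ l') (h3 : l' ≤ l) : span h k' l' ^ α ≤ span h k l ^ α :=
  Real.rpow_le_rpow (span_nonneg hD.pos.le h2) (span_mono hD.pos.le h1 h3) hα

/-- This is where α ≤ 1/2 enters the a priori bounds: elapsed time, and with it the drift, counts as
second order in ω. -/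
theorem le_rpow_sq {x : ℝ} (hx : 0 ≤ x) (hx1 : x ≤ 1) (hα2 : α ≤ 1 / 2) :
    x ≤ (x ^ α) ^ 2 := by
  rw [← Real.rpow_natCast, ← Real.rpow_mul hx]
  have h1 : α * (2 : ℕ) ≤ 1 := by push_cast; linarith
  exact Real.self_le_rpow_of_le_one hx hx1 h1

theorem GridDriver.span_le_sq (hD : GridDriver α h K L N z a) (hα2 : α ≤ 1 / 2)
    {k l : ℕ} (hkl : k ≤ l) (hl : l ≤ N) : span h k l ≤ (span h k l ^ α) ^ 2 :=
  le_rpow_sq (span_nonneg hD.pos.le hkl) (hD.span_le_one hl) hα2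

theorem abs_sum_le_card_mul {ι : Type*} [Fintype ι] {f : ι → ℝ} {c : ℝ} (h : ∀ i, |f i| ≤ c) :
    |∑ i, f i| ≤ Fintype.card ι * c :=
  (Finset.abs_sum_le_sum_abs _ _).trans
    ((Finset.sum_le_card_nsmul _ _ c fun i _ => h i).trans (by simp))

theorem abs_triple_sum_le {f : Fin d' → Fin d → Fin d' → ℝ} {c : ℝ} (h : ∀ j p m, |f j p m| ≤ c) :
    |∑ j, ∑ p, ∑ m, f j p m| ≤ d * d' ^ 2 * c := by
  have := abs_sum_le_card_mul fun j => abs_sum_le_card_mul fun p => abs_sum_le_card_mul (h j p)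
  refine this.trans_eq ?_
  simp only [Fintype.card_fin]; ring

end Driver

/-! ### Failure of additivity of the second-order increment -/

section ThreePoint

variable {d d' N : ℕ} {α h K L M : ℝ} {z : ℕ → Fin d' → ℝ} {a : ℕ → ℕ → Fin d' → Fin d' → ℝ}
  {μ : (Fin d → ℝ) → Fin d → ℝ} {σ : (Fin d → ℝ) → Fin d → Fin d' → ℝ}

theorem GridDriver.area_self (hD : GridDriver α h K L N z a) (hα : 0 < α) {k : ℕ} (hk : k ≤ N)
    (i j : Fin d') : a k k i j = 0 := by
  have := hD.area_le k k le_rfl hk i j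
  rw [span_self, Real.zero_rpow hα.ne'] at this
  simpa using this

theorem GridDriver.gridIncrement_self (hD : GridDriver α h K L N z a) (hα : 0 < α) {k : ℕ}
    (hk : k ≤ N) (x : Fin d → ℝ) : gridIncrement μ σ z a h k k x = 0 := by
  ext i
  simp [gridIncrement, noise, linearTerm, areaTerm, hD.area_self hα hk]

/-- Expanding the area over [k,l] by Chen's relation produces the product of path increments, which
is the derivative of `σ` along `linearTerm` paired with the second path increment. What is left is a
Taylor remainder against the path and a change of coefficient against the area. -/
theorem noise_three_point (hD : GridDriver α h K L N z a) {k m l : ℕ} (hkm : k ≤ m) (hml : m ≤ l)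
    (hl : l ≤ N) (x x' : Fin d → ℝ) (i : Fin d) :
    noise σ z a k m x i + noise σ z a m l x' i - noise σ z a k l x i
      = ∑ j, (σ x' i j - σ x i j - ∑ p, partialDeriv σ p i j x * linearTerm σ z k m x p)
          * (z l j - z m j)
        + ∑ j, ∑ p, ∑ q, (partialDeriv σ p i j x' * σ x' p q - partialDeriv σ p i j x * σ x p q)
          * a m l q j := by
  simp only [noise, Pi.add_apply, areaTerm, linearTerm]
  simp only [← Finset.sum_add_distrib, ← Finset.sum_sub_distrib]
  refine Finset.sum_congr rfl fun j _ => ?_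
  have e1 : ∑ p, ∑ q, partialDeriv σ p i j x * σ x p q * a k l q j
      = ∑ p, ∑ q, partialDeriv σ p i j x * σ x p q * a k m q j
        + ∑ p, ∑ q, partialDeriv σ p i j x * σ x p q * a m l q j
        + (∑ p, partialDeriv σ p i j x * ∑ q, σ x p q * (z m q - z k q)) * (z l j - z m j) := by
    rw [Finset.sum_mul, ← Finset.sum_add_distrib, ← Finset.sum_add_distrib]
    refine Finset.sum_congr rfl fun p _ => ?_
    rw [Finset.mul_sum, Finset.sum_mul, ← Finset.sum_add_distrib, ← Finset.sum_add_distrib]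
    refine Finset.sum_congr rfl fun q _ => ?_
    rw [hD.chen k m l hkm hml hl q j]; ring
  have e2 : ∑ p, ∑ q, (partialDeriv σ p i j x' * σ x' p q - partialDeriv σ p i j x * σ x p q)
          * a m l q j = ∑ p, ∑ q, partialDeriv σ p i j x' * σ x' p q * a m l q j
        - ∑ p, ∑ q, partialDeriv σ p i j x * σ x p q * a m l q j := by
    simp only [sub_mul, Finset.sum_sub_distrib]
  rw [e1, e2]; ring

theorem abs_linearTerm_le (hc : CoeffBounds μ σ M) (hM : 0 ≤ M) (hD : GridDriver α h K L N z a)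
    {k l : ℕ} (hkl : k ≤ l) (hl : l ≤ N) (x : Fin d → ℝ) (i : Fin d) :
    |linearTerm σ z k l x i| ≤ d' * M * K * span h k l ^ α :=
  (abs_sum_mul_le (fun j => (hc.boundedDeriv_diffusion i j).abs_le x) hM
    (hD.path_le k l hkl hl)).trans_eq (by ring)

theorem abs_areaTerm_le (hc : CoeffBounds μ σ M) (hM : 0 ≤ M) (hD : GridDriver α h K L N z a)
    {k l : ℕ} (hkl : k ≤ l) (hl : l ≤ N) (x : Fin d → ℝ) (i : Fin d) :
    |areaTerm σ a k l x i| ≤ d * d' ^ 2 * M ^ 2 * L * (span h k l ^ α) ^ 2 := by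
  refine (abs_triple_sum_le (c := M * M * (L * (span h k l ^ α) ^ 2)) fun j p q => ?_).trans_eq
    (by ring)
  rw [abs_mul, abs_mul, hc.pd_diffusion]
  have h1 := ((hc.boundedDeriv_diffusion i j).2.2 p).abs_le x
  have h2 := (hc.boundedDeriv_diffusion p q).abs_le x
  have h3 := hD.area_le k l hkl hl q j
  gcongr

theorem abs_linearTerm_sub_le (hc : CoeffBounds μ σ M) (hM : 0 ≤ M)
    (hD : GridDriver α h K L N z a) {k l : ℕ} (hkl : k ≤ l) (hl : l ≤ N) (x y : Fin d → ℝ)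
    (i : Fin d) : |linearTerm σ z k l x i - linearTerm σ z k l y i|
      ≤ d * d' * M * K * span h k l ^ α * ‖x - y‖ := by
  simp only [linearTerm, ← Finset.sum_sub_distrib, ← sub_mul]
  exact (abs_sum_mul_le (fun j => (hc.boundedDeriv_diffusion i j).abs_sub_le hM x y)
    (by positivity) (hD.path_le k l hkl hl)).trans_eq (by ring)

theorem abs_area_coeff_sub_le (hc : CoeffBounds μ σ M) (hM : 0 ≤ M) (x y : Fin d → ℝ)
    (i p : Fin d) (j q : Fin d') :
    |partialDeriv σ p i j x * σ x p q - partialDeriv σ p i j y * σ y p q|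
      ≤ 2 * d * M ^ 2 * ‖x - y‖ := by
  rw [hc.pd_diffusion]
  have h2 : BoundedDeriv M (1 + 1) (pd p fun x => σ x i j) :=
    (hc.boundedDeriv_diffusion i j).2.2 p
  have h3 := hc.boundedDeriv_diffusion p q
  exact (abs_mul_sub_mul_le (h2.abs_le y) (h3.abs_le x) (h2.abs_sub_le hM x y)
    (h3.abs_sub_le hM x y)).trans_eq (by ring)

theorem abs_area_sum_sub_le (hc : CoeffBounds μ σ M) (hM : 0 ≤ M)
    (hD : GridDriver α h K L N z a) {k l : ℕ} (hkl : k ≤ l) (hl : l ≤ N) (x y : Fin d → ℝ)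
    (i : Fin d) : |∑ j, ∑ p, ∑ q,
      (partialDeriv σ p i j x * σ x p q - partialDeriv σ p i j y * σ y p q) * a k l q j|
      ≤ 2 * d ^ 2 * d' ^ 2 * M ^ 2 * L * (span h k l ^ α) ^ 2 * ‖x - y‖ := by
  refine (abs_triple_sum_le
    (c := 2 * d * M ^ 2 * ‖x - y‖ * (L * (span h k l ^ α) ^ 2)) fun j p q => ?_).trans_eq
    (by ring)
  rw [abs_mul]
  have h1 := abs_area_coeff_sub_le hc hM x y i p j q
  have h3 := hD.area_le k l hkl hl q j
  gcongr

theorem abs_areaTerm_sub_le (hc : CoeffBounds μ σ M) (hM : 0 ≤ M)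
    (hD : GridDriver α h K L N z a) {k l : ℕ} (hkl : k ≤ l) (hl : l ≤ N) (x y : Fin d → ℝ)
    (i : Fin d) : |areaTerm σ a k l x i - areaTerm σ a k l y i|
      ≤ 2 * d ^ 2 * d' ^ 2 * M ^ 2 * L * (span h k l ^ α) ^ 2 * ‖x - y‖ := by
  refine le_trans (le_of_eq ?_) (abs_area_sum_sub_le hc hM hD hkl hl x y i)
  simp only [areaTerm, sub_mul, Finset.sum_sub_distrib]

/-- Each contribution is cubic in ω: drift change (ω) times time (ω²), Taylor remainder (ω²) times
path (ω), coefficient change (ω) times area (ω²). The constants add up to `kappa`. -/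
theorem gridIncrement_three_point (hc : CoeffBounds μ σ M) (hM : 0 ≤ M) (hK : 0 ≤ K) (hL : 0 ≤ L)
    (hα : 0 < α) (hα2 : α ≤ 1 / 2) (hD : GridDriver α h K L N z a) {c₁ c₂ : ℝ} (hc₁ : 0 ≤ c₁)
    (hc₂ : 0 ≤ c₂) {k m l : ℕ} (hkm : k ≤ m) (hml : m ≤ l) (hl : l ≤ N) {x x' : Fin d → ℝ}
    (h₁ : ‖x' - x‖ ≤ c₁ * span h k m ^ α)
    (h₂ : ‖x' - x - span h k m • μ x - linearTerm σ z k m x‖ ≤ c₂ * (span h k m ^ α) ^ 2) :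
    ‖gridIncrement μ σ z a h k m x + gridIncrement μ σ z a h m l x'
        - gridIncrement μ σ z a h k l x‖ ≤ kappa d d' M K L c₁ c₂ * (span h k l ^ α) ^ 3 := by
  have hκ : 0 ≤ kappa d d' M K L c₁ c₂ := by unfold kappa; positivity
  have hω := hD.rpow_nonneg (hkm.trans hml)
  have hω1 := hD.rpow_nonneg hkm
  have hω2 := hD.rpow_nonneg hml
  have hm1 := hD.rpow_mono hα.le le_rfl hkm hml
  have hm2 := hD.rpow_mono hα.le hkm hml le_rfl
  have hs2 := hD.span_le_sq hα2 hml hl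
  have hs1 := hD.span_le_sq hα2 hkm (hml.trans hl)
  have hn2 := span_nonneg hD.pos.le hml
  have hn1 := span_nonneg hD.pos.le hkm
  refine (pi_norm_le_iff_of_nonneg (by positivity)).2 fun i => ?_
  set W := span h k l ^ α with hW
  have hu : ‖x' - x‖ ≤ c₁ * W := h₁.trans (by gcongr)
  -- The Taylor term uses the full increment, while Chen's relation supplies only its linear part in
  -- the path; the drift omitted there accounts for the extra `M`.
  have hlin : ∀ p, |(x' - x) p - linearTerm σ z k m x p| ≤ (c₂ + M) * W ^ 2 := by
    intro p
    have e : (x' - x) p - linearTerm σ z k m x p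
        = (x' - x - span h k m • μ x - linearTerm σ z k m x) p + span h k m * μ x p := by
      simp only [Pi.sub_apply, Pi.smul_apply, smul_eq_mul]; ring
    rw [e]
    have g1 : |span h k m * μ x p| ≤ W ^ 2 * M := by
      rw [abs_mul, abs_of_nonneg hn1]
      have := hc.drift_le x p
      have : span h k m ≤ W ^ 2 := hs1.trans (by gcongr)
      gcongr
    have g2 := (abs_apply_le_norm (x' - x - span h k m • μ x - linearTerm σ z k m x) p).trans h₂
    have g3 : c₂ * (span h k m ^ α) ^ 2 ≤ c₂ * W ^ 2 := by gcongr
    refine (abs_add_le _ _).trans ?_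
    linarith
  have e := noise_three_point (σ := σ) hD hkm hml hl x x' i
  have hspan := span_add_span h k m l
  have e' : (gridIncrement μ σ z a h k m x + gridIncrement μ σ z a h m l x'
        - gridIncrement μ σ z a h k l x) i = (μ x' i - μ x i) * span h m l
      + (noise σ z a k m x i + noise σ z a m l x' i - noise σ z a k l x i) := by
    simp only [gridIncrement, Pi.sub_apply, Pi.add_apply, Pi.smul_apply, smul_eq_mul, ← hspan]
    ring
  rw [e', e, Real.norm_eq_abs]
  have t1 : |(μ x' i - μ x i) * span h m l| ≤ d * M * (c₁ * W) * W ^ 2 := by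
    rw [abs_mul, abs_of_nonneg hn2]
    have g1 := (hc.boundedDeriv_drift i).abs_sub_le hM x' x
    have g1 : |μ x' i - μ x i| ≤ d * M * (c₁ * W) := g1.trans (by gcongr)
    have g2 : span h m l ≤ W ^ 2 := hs2.trans (by gcongr)
    gcongr
  have t2 : |∑ j, (σ x' i j - σ x i j - ∑ p, partialDeriv σ p i j x * linearTerm σ z k m x p)
          * (z l j - z m j)| ≤ d' * ((d ^ 2 * M * (c₁ * W) ^ 2 + d * (M * ((c₂ + M) * W ^ 2)))
            * (K * W)) := by
    refine abs_sum_mul_le (fun j => ?_) (by positivity) (fun j => ?_)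
    · have hf := hc.boundedDeriv_diffusion i j
      have g1 := BoundedDeriv.abs_taylor_le (k := 1) hM hf x (x' - x)
      rw [add_sub_cancel] at g1
      have g2 := abs_sum_mul_le (g := fun p => partialDeriv σ p i j x)
        (v := fun p => (x' - x) p - linearTerm σ z k m x p) (P := M)
        (fun p => by rw [hc.pd_diffusion]; exact (hf.2.2 p).abs_le x) hM hlin
      have e3 : σ x' i j - σ x i j - ∑ p, partialDeriv σ p i j x * linearTerm σ z k m x p
          = (σ x' i j - σ x i j - ∑ p, pd p (fun x => σ x i j) x * (x' - x) p)
            + ∑ p, partialDeriv σ p i j x * ((x' - x) p - linearTerm σ z k m x p) := by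
        simp only [hc.pd_diffusion, mul_sub, Finset.sum_sub_distrib]; ring
      rw [e3]
      refine (abs_add_le _ _).trans (add_le_add (g1.trans ?_) g2)
      gcongr
    · exact (hD.path_le m l hml hl j).trans (by gcongr)
  have t3 := abs_area_sum_sub_le hc hM hD hml hl x' x i
  have t3' : 2 * d ^ 2 * d' ^ 2 * M ^ 2 * L * (span h m l ^ α) ^ 2 * ‖x' - x‖
      ≤ 2 * d ^ 2 * d' ^ 2 * M ^ 2 * L * W ^ 2 * (c₁ * W) := by gcongr
  refine (abs_add_le _ _).trans ((add_le_add t1 ((abs_add_le _ _).trans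
    (add_le_add t2 (t3.trans t3')))).trans_eq ?_)
  unfold kappa
  ring

end ThreePoint

/-! ### Signs and choice of the constants -/

section Constants

variable {d d' : ℕ} {α K L M : ℝ}

theorem kappa_nonneg (hM : 0 ≤ M) (hK : 0 ≤ K) (hL : 0 ≤ L) {c₁ c₂ : ℝ} (h₁ : 0 ≤ c₁)
    (h₂ : 0 ≤ c₂) : 0 ≤ kappa d d' M K L c₁ c₂ := by unfold kappa; positivity

theorem locC1_pos (hM : 0 ≤ M) (hK : 0 ≤ K) (hL : 0 ≤ L) : 0 < locC1 d d' M K L := by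
  unfold locC1; positivity

theorem locC2_pos (hL : 0 ≤ L) : 0 < locC2 d d' M L := by
  unfold locC2; positivity

theorem one_sub_two_rpow_pos (hα : 1 / 3 < α) : (0 : ℝ) < 1 - 2 ^ (1 - 3 * α) :=
  sub_pos.2 (Real.rpow_lt_one_of_one_lt_of_neg one_lt_two (by linarith))

/-- The factor ρ is the one for which the sewing condition on `c` and `κ` holds with equality. -/
theorem two_mul_eq_of_ratio (hα : 1 / 3 < α) (κ : ℝ) :
    2 * κ = (1 - 2 ^ (1 - 3 * α)) * (2 / (1 - 2 ^ (1 - 3 * α)) * κ) := by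
  have := (one_sub_two_rpow_pos hα).ne'
  field_simp

theorem locC3_nonneg (hα : 1 / 3 < α) (hM : 0 ≤ M) (hK : 0 ≤ K) (hL : 0 ≤ L) :
    0 ≤ locC3 d d' α M K L :=
  mul_nonneg (div_nonneg zero_le_two (one_sub_two_rpow_pos hα).le)
    (kappa_nonneg hM hK hL (locC1_pos hM hK hL).le (locC2_pos hL).le)

theorem rpow_neg_one_div_le_half {c : ℝ} (hα : 0 < α) (hα1 : α ≤ 1) (hc : 2 ≤ c) :
    c ^ (-(1 / α)) ≤ 1 / 2 := by
  have hc0 : 0 < c := by linarith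
  have h1 : (1 : ℝ) ≤ 1 / α := by rw [le_div_iff₀ hα]; linarith
  calc c ^ (-(1 / α)) ≤ c ^ (-1 : ℝ) :=
        Real.rpow_le_rpow_of_exponent_le (by linarith) (by linarith)
    _ = 1 / c := by rw [Real.rpow_neg_one, one_div]
    _ ≤ 1 / 2 := one_div_le_one_div_of_le two_pos hc

/-- Explains the form of `delta` and `delta'`: on windows of such length ω is at most the reciprocal
of the base. -/
theorem rpow_le_inv_of_le {c x : ℝ} (hα : 0 < α) (hc : 0 < c) (hx : 0 ≤ x)
    (h : x ≤ c ^ (-(1 / α))) : x ^ α ≤ c⁻¹ := by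
  refine (Real.rpow_le_rpow hx h hα.le).trans_eq ?_
  rw [← Real.rpow_mul hc.le, neg_mul, one_div_mul_cancel hα.ne', Real.rpow_neg_one]

theorem delta_pos (hα : 1 / 3 < α) (hM : 0 ≤ M) (hK : 0 ≤ K) (hL : 0 ≤ L) :
    0 < delta d d' α M K L :=
  Real.rpow_pos_of_pos (by linarith [locC3_nonneg (d := d) (d' := d') hα hM hK hL]) _

theorem constC1_pos (hα : 1 / 3 < α) (hM : 0 ≤ M) (hK : 0 ≤ K) (hL : 0 ≤ L) :
    0 < constC1 d d' α M K L :=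
  mul_pos (div_pos two_pos (delta_pos hα hM hK hL)) (locC1_pos hM hK hL)

theorem constC2_pos (hα : 1 / 3 < α) (hM : 0 ≤ M) (hK : 0 ≤ K) (hL : 0 ≤ L) :
    0 < constC2 d d' α M K L := by
  have h1 := constC1_pos (d := d) (d' := d') hα hM hK hL
  have h2 := locC2_pos (d := d) (d' := d') (M := M) hL
  have h3 := delta_pos (d := d) (d' := d') hα hM hK hL
  unfold constC2
  positivity

theorem constC3_nonneg (hα : 1 / 3 < α) (hM : 0 ≤ M) (hK : 0 ≤ K) (hL : 0 ≤ L) :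
    0 ≤ constC3 d d' α M K L :=
  mul_nonneg (div_nonneg zero_le_two (one_sub_two_rpow_pos hα).le)
    (kappa_nonneg hM hK hL (constC1_pos hα hM hK hL).le (constC2_pos hα hM hK hL).le)

end Constants

/-! ### Covering the unit interval by windows -/

theorem eq_of_span_nonpos {h : ℝ} (hh : 0 < h) {k l : ℕ} (hkl : k ≤ l) (hs : span h k l ≤ 0) :
    k = l := by
  by_contra hne
  have h1 := span_mono hh.le (le_refl k) (Nat.succ_le_of_lt (lt_of_le_of_ne hkl hne))
  rw [Nat.succ_eq_add_one, span_succ] at h1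
  linarith

/-- A grid point at distance between `2δ/3` and `δ`. -/
theorem exists_grid_step {h δ : ℝ} (hh : 0 < h) (hδ : 3 * h ≤ δ) {k l : ℕ}
    (hkl : δ < span h k l) : ∃ m, k ≤ m ∧ m ≤ l ∧ span h k m ≤ δ ∧ 2 * δ / 3 ≤ span h k m := by
  have hδ0 : 0 ≤ δ := by linarith
  have h1 : span h k (k + ⌊δ / h⌋₊) = ⌊δ / h⌋₊ * h := by simp [span]
  have h2 : (⌊δ / h⌋₊ : ℝ) * h ≤ δ := by
    rw [← le_div_iff₀ hh]; exact Nat.floor_le (by positivity)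
  have h3 : δ < (⌊δ / h⌋₊ + 1) * h := by
    rw [← div_lt_iff₀ hh]; exact Nat.lt_floor_add_one _
  -- As many whole cells as fit into δ fall short of it by less than h, hence by less than δ/3.
  refine ⟨k + ⌊δ / h⌋₊, by omega, ?_, h1 ▸ h2, by rw [h1]; linarith⟩
  by_contra hcon
  have := span_mono hh.le (le_refl k) (not_le.1 hcon).le
  linarith

/-- Steps of length at least 2δ/3 cover [0,1] in ⌈3/(2δ)⌉ windows; this count is the origin of the
2/δ in the constants. -/
theorem natCeil_three_halves_div_le {δ : ℝ} (hδ : 0 < δ) (hδ2 : δ ≤ 1 / 2) :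
    (⌈3 / (2 * δ)⌉₊ : ℝ) ≤ 2 / δ := by
  refine (Nat.ceil_lt_add_one (by positivity)).le.trans ?_
  have h1 : 1 ≤ 1 / (2 * δ) := by rw [le_div_iff₀ (by positivity)]; linarith
  have h2 : 2 / δ = 3 / (2 * δ) + 1 / (2 * δ) := by field_simp; norm_num
  linarith

theorem one_le_natCeil_mul {δ : ℝ} (hδ : 0 < δ) : 1 ≤ (⌈3 / (2 * δ)⌉₊ : ℝ) * (2 * δ / 3) := by
  have := mul_le_mul_of_nonneg_right (Nat.le_ceil (3 / (2 * δ))) (by positivity : 0 ≤ 2 * δ / 3)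
  refine le_trans (le_of_eq ?_) this
  field_simp

/-! ### A priori bounds along a grid -/

/-- The second-order remainder of a sequence along the grid. -/
noncomputable def remainder {d d' : ℕ} (μ : (Fin d → ℝ) → Fin d → ℝ)
    (σ : (Fin d → ℝ) → Fin d → Fin d' → ℝ) (z : ℕ → Fin d' → ℝ)
    (a : ℕ → ℕ → Fin d' → Fin d' → ℝ) (h : ℝ) (y : ℕ → Fin d → ℝ) (k l : ℕ) : Fin d → ℝ :=
  y l - y k - gridIncrement μ σ z a h k l (y k)

/-- The first-order remainder of a sequence along the grid. -/
noncomputable def firstRemainder {d d' : ℕ} (μ : (Fin d → ℝ) → Fin d → ℝ)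
    (σ : (Fin d → ℝ) → Fin d → Fin d' → ℝ) (z : ℕ → Fin d' → ℝ)
    (h : ℝ) (y : ℕ → Fin d → ℝ) (k l : ℕ) : Fin d → ℝ :=
  y l - y k - span h k l • μ (y k) - linearTerm σ z k l (y k)

section Bounds

variable {d d' N : ℕ} {α h K L M ε : ℝ} {z : ℕ → Fin d' → ℝ} {a : ℕ → ℕ → Fin d' → Fin d' → ℝ}
  {μ : (Fin d → ℝ) → Fin d → ℝ} {σ : (Fin d → ℝ) → Fin d → Fin d' → ℝ} {y : ℕ → Fin d → ℝ}

theorem remainder_split_le (hc : CoeffBounds μ σ M) (hM : 0 ≤ M) (hK : 0 ≤ K) (hL : 0 ≤ L)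
    (hα : 0 < α) (hα2 : α ≤ 1 / 2) (hD : GridDriver α h K L N z a) {c₁ c₂ : ℝ} (hc₁ : 0 ≤ c₁)
    (hc₂ : 0 ≤ c₂) {k m l : ℕ} (hkm : k ≤ m) (hml : m ≤ l) (hl : l ≤ N)
    (h₁ : ‖y m - y k‖ ≤ c₁ * span h k m ^ α)
    (h₂ : ‖firstRemainder μ σ z h y k m‖ ≤ c₂ * (span h k m ^ α) ^ 2) :
    ‖remainder μ σ z a h y k l‖ ≤ ‖remainder μ σ z a h y k m‖ + ‖remainder μ σ z a h y m l‖
      + kappa d d' M K L c₁ c₂ * (span h k l ^ α) ^ 3 := by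
  have e : remainder μ σ z a h y k l = remainder μ σ z a h y k m + remainder μ σ z a h y m l
      + (gridIncrement μ σ z a h k m (y k) + gridIncrement μ σ z a h m l (y m)
        - gridIncrement μ σ z a h k l (y k)) := by
    simp only [remainder]; abel
  rw [e]
  exact (norm_add_le _ _).trans (add_le_add (norm_add_le _ _)
    (gridIncrement_three_point hc hM hK hL hα hα2 hD hc₁ hc₂ hkm hml hl h₁ h₂))

theorem remainder_self (hα : 0 < α) (hD : GridDriver α h K L N z a) {k : ℕ} (hk : k ≤ N) :
    remainder μ σ z a h y k k = 0 := by
  simp [remainder, hD.gridIncrement_self hα hk]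

theorem firstRemainder_self (k : ℕ) : firstRemainder μ σ z h y k k = 0 := by
  ext i; simp [firstRemainder, linearTerm]

theorem firstRemainder_le_of_remainder_le (hc : CoeffBounds μ σ M) (hM : 0 ≤ M) (hL : 0 ≤ L)
    (hD : GridDriver α h K L N z a) {k l : ℕ} (hkl : k ≤ l) (hl : l ≤ N)
    (hR : ‖remainder μ σ z a h y k l‖ ≤ (span h k l ^ α) ^ 2) :
    ‖firstRemainder μ σ z h y k l‖ ≤ locC2 d d' M L * (span h k l ^ α) ^ 2 := by
  have hC := (locC2_pos (d := d) (d' := d') (M := M) hL).le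
  refine (pi_norm_le_iff_of_nonneg (by positivity)).2 fun i => ?_
  have e : firstRemainder μ σ z h y k l i
      = remainder μ σ z a h y k l i + areaTerm σ a k l (y k) i := by
    simp only [firstRemainder, remainder, gridIncrement, noise, Pi.sub_apply, Pi.add_apply]; ring
  rw [e, Real.norm_eq_abs]
  have h1 := (abs_apply_le_norm (remainder μ σ z a h y k l) i).trans hR
  have h2 := abs_areaTerm_le hc hM hD hkl hl (y k) i
  refine (abs_add_le _ _).trans ((add_le_add h1 h2).trans_eq ?_)
  unfold locC2; ring

theorem norm_sub_le_of_remainder_le (hc : CoeffBounds μ σ M) (hM : 0 ≤ M) (hK : 0 ≤ K)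
    (hL : 0 ≤ L) (hα : 0 < α) (hα2 : α ≤ 1 / 2) (hD : GridDriver α h K L N z a) {k l : ℕ}
    (hkl : k ≤ l) (hl : l ≤ N) (hR : ‖remainder μ σ z a h y k l‖ ≤ (span h k l ^ α) ^ 2) :
    ‖y l - y k‖ ≤ locC1 d d' M K L * span h k l ^ α := by
  have hC := (locC1_pos (d := d) (d' := d') hM hK hL).le
  have hω := hD.rpow_nonneg hkl
  refine (pi_norm_le_iff_of_nonneg (by positivity)).2 fun i => ?_
  have e : (y l - y k) i
      = firstRemainder μ σ z h y k l i + span h k l * μ (y k) i + linearTerm σ z k l (y k) i := by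
    simp only [firstRemainder, Pi.sub_apply, Pi.smul_apply, smul_eq_mul]; ring
  rw [e, Real.norm_eq_abs]
  have hsq : (span h k l ^ α) ^ 2 ≤ span h k l ^ α := by
    have := hD.rpow_le_one hα.le hkl hl
    nlinarith
  have h1 := (abs_apply_le_norm (firstRemainder μ σ z h y k l) i).trans
    (firstRemainder_le_of_remainder_le hc hM hL hD hkl hl hR)
  have h1' := mul_le_mul_of_nonneg_left hsq (locC2_pos (d := d) (d' := d') (M := M) hL).le
  have h2 : |span h k l * μ (y k) i| ≤ span h k l ^ α * M := by
    rw [abs_mul, abs_of_nonneg (span_nonneg hD.pos.le hkl)]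
    exact mul_le_mul ((hD.span_le_sq hα2 hkl hl).trans hsq) (hc.drift_le _ _) (abs_nonneg _) hω
  have h3 := abs_linearTerm_le hc hM hD hkl hl (y k) i
  refine (abs_add_le _ _).trans ((add_le_add ((abs_add_le _ _).trans
    (add_le_add (h1.trans h1') h2)) h3).trans_eq ?_)
  unfold locC1 locC2; ring

theorem cube_add_mul_span_le_sq (hα2 : α ≤ 1 / 2) (hD : GridDriver α h K L N z a)
    {c ε e : ℝ} (hε0 : 0 ≤ ε) (hε : ε ≤ e) (hc : 0 ≤ c) {k l : ℕ} (hkl : k ≤ l)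
    (hl : l ≤ N) {s : ℝ} (hω : span h k l ^ α ≤ s) (hs : c * s + e ≤ 1) :
    c * (span h k l ^ α) ^ 3 + ε * span h k l ≤ (span h k l ^ α) ^ 2 := by
  have h1 := hD.span_le_sq hα2 hkl hl
  have h2 := hD.rpow_nonneg hkl
  calc c * (span h k l ^ α) ^ 3 + ε * span h k l
      ≤ c * (span h k l ^ α) ^ 3 + ε * (span h k l ^ α) ^ 2 := by gcongr
    _ = (c * span h k l ^ α + ε) * (span h k l ^ α) ^ 2 := by ring
    _ ≤ 1 * (span h k l ^ α) ^ 2 := by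
        have : c * span h k l ^ α ≤ c * s := by gcongr
        gcongr
        linarith
    _ = _ := one_mul _

/-- A bootstrap inside the sewing induction: the induction hypothesis on [k,m] gives a remainder of
at most ω², hence the increment bounds with `locC1` and `locC2` that the three-point estimate needs
in order to split [k,l]. -/
theorem local_remainder_le_sq (hc : CoeffBounds μ σ M) (hM : 0 ≤ M) (hK : 0 ≤ K) (hL : 0 ≤ L)
    (hα : 1 / 3 < α) (hα2 : α ≤ 1 / 2) (hD : GridDriver α h K L N z a) (hε0 : 0 ≤ ε)
    (hε : ε ≤ (2 + locC3 d d' α M K L)⁻¹)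
    (hadj : ∀ k < N, ‖remainder μ σ z a h y k (k + 1)‖ ≤ ε * h) {k l : ℕ} (hkl : k ≤ l)
    (hl : l ≤ N) (hδ : span h k l ≤ delta d d' α M K L) :
    ‖remainder μ σ z a h y k l‖ ≤ (span h k l ^ α) ^ 2 := by
  have hα0 : 0 < α := by linarith
  have hc3 := locC3_nonneg (d := d) (d' := d') hα hM hK hL
  have hc1 := (locC1_pos (d := d) (d' := d') hM hK hL).le
  have hc2 := (locC2_pos (d := d) (d' := d') (M := M) hL).le
  have key : ∀ k l, k ≤ l → l ≤ N → span h k l ≤ delta d d' α M K L →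
      locC3 d d' α M K L * (span h k l ^ α) ^ 3 + ε * span h k l ≤ (span h k l ^ α) ^ 2 := by
    intro k l hkl hl hδ
    refine cube_add_mul_span_le_sq hα2 hD hε0 hε hc3 hkl hl
      (rpow_le_inv_of_le hα0 (by linarith) (span_nonneg hD.pos.le hkl) hδ) ?_
    -- Both ω and `ε` are at most 1/(2+c₃), so c₃ω + ε ≤ (c₃+1)/(2+c₃) ≤ 1.
    rw [← add_one_mul, mul_inv_le_iff₀ (by linarith)]
    linarith
  refine (grid_sewing (E := fun k l => ‖remainder μ σ z a h y k l‖) hα0.le hD.pos.le hc3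
    (kappa_nonneg hM hK hL hc1 hc2) (two_mul_eq_of_ratio hα _).le
    (fun k hk => by simp [remainder_self hα0 hD hk]) hadj ?_ hkl hl hδ).trans (key k l hkl hl hδ)
  intro k m l hkm hml hl hδ IH
  have hm := hml.le.trans hl
  have hδm := (span_mono hD.pos.le (le_refl k) hml.le).trans hδ
  have hR := (IH k m le_rfl hkm.le hml.le (by omega)).trans (key k m hkm.le hm hδm)
  exact remainder_split_le hc hM hK hL hα0 hα2 hD hc1 hc2 hkm.le hml.le hl
    (norm_sub_le_of_remainder_le hc hM hK hL hα0 hα2 hD hkm.le hm hR)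
    (firstRemainder_le_of_remainder_le hc hM hL hD hkm.le hm hR)

theorem delta_le_half (hα : 1 / 3 < α) (hα2 : α ≤ 1 / 2) (hM : 0 ≤ M) (hK : 0 ≤ K) (hL : 0 ≤ L) :
    delta d d' α M K L ≤ 1 / 2 :=
  rpow_neg_one_div_le_half (by linarith) (by linarith)
    (by linarith [locC3_nonneg (d := d) (d' := d') hα hM hK hL])

/-- Increments over consecutive windows add by the triangle inequality, each being at most c₁ times
the ω of the whole interval; at most 2/δ windows occur. -/
theorem norm_sub_le (hc : CoeffBounds μ σ M) (hM : 0 ≤ M) (hK : 0 ≤ K) (hL : 0 ≤ L)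
    (hα : 1 / 3 < α) (hα2 : α ≤ 1 / 2) (hD : GridDriver α h K L N z a) (hε0 : 0 ≤ ε)
    (hε : ε ≤ (2 + locC3 d d' α M K L)⁻¹) (hh : 3 * h ≤ delta d d' α M K L)
    (hadj : ∀ k < N, ‖remainder μ σ z a h y k (k + 1)‖ ≤ ε * h) {k l : ℕ} (hkl : k ≤ l)
    (hl : l ≤ N) : ‖y l - y k‖ ≤ constC1 d d' α M K L * span h k l ^ α := by
  have hα0 : 0 < α := by linarith
  have hc1 := (locC1_pos (d := d) (d' := d') hM hK hL).le
  have hδ := delta_pos (d := d) (d' := d') hα hM hK hL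
  have hδ2 := delta_le_half (d := d) (d' := d') hα hα2 hM hK hL
  have hloc : ∀ k l, k ≤ l → l ≤ N → span h k l ≤ delta d d' α M K L →
      ‖y l - y k‖ ≤ locC1 d d' M K L * span h k l ^ α := fun k l hkl hl hs =>
    norm_sub_le_of_remainder_le hc hM hK hL hα0 hα2 hD hkl hl
      (local_remainder_le_sq hc hM hK hL hα hα2 hD hε0 hε hadj hkl hl hs)
  have key : ∀ p : ℕ, ∀ k l, k ≤ l → l ≤ N → span h k l ≤ p * (2 * delta d d' α M K L / 3) →
      ‖y l - y k‖ ≤ p * (locC1 d d' M K L * span h k l ^ α) := by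
    intro p
    induction p with
    | zero =>
      intro k l hkl hl hs
      obtain rfl := eq_of_span_nonpos hD.pos hkl (by simpa using hs)
      simp
    | succ p ih =>
      intro k l hkl hl hs
      have hω := hD.rpow_nonneg hkl
      have hcω : 0 ≤ locC1 d d' M K L * span h k l ^ α := by positivity
      have hcωp : 0 ≤ p * (locC1 d d' M K L * span h k l ^ α) := by positivity
      push_cast at hs ⊢
      by_cases hsd : span h k l ≤ delta d d' α M K L
      · have := hloc k l hkl hl hsd
        linarith
      · obtain ⟨m, hkm, hml, hm1, hm2⟩ := exists_grid_step hD.pos hh (not_le.1 hsd)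
        have h1 := hloc k m hkm (hml.trans hl) hm1
        have h2 := ih m l hml hl (by linarith [span_add_span h k m l])
        have g1 := hD.rpow_mono hα0.le (le_refl k) hkm hml
        have g2 := hD.rpow_mono hα0.le hkm hml (le_refl l)
        have h1' : ‖y m - y k‖ ≤ locC1 d d' M K L * span h k l ^ α := h1.trans (by gcongr)
        have h2' : ‖y l - y m‖ ≤ p * (locC1 d d' M K L * span h k l ^ α) := h2.trans (by gcongr)
        have := norm_add_le (y l - y m) (y m - y k)
        rw [sub_add_sub_cancel] at this
        linarith
  have h1 := key ⌈3 / (2 * delta d d' α M K L)⌉₊ k l hkl hl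
    ((hD.span_le_one hl).trans (one_le_natCeil_mul hδ))
  have hω := hD.rpow_nonneg hkl
  refine h1.trans ?_
  rw [constC1, mul_assoc]
  exact mul_le_mul_of_nonneg_right (natCeil_three_halves_div_le hδ hδ2) (by positivity)

/-- The first-order remainder is not additive. Restarting at `m` changes the coefficients from y k
to y m, which by `norm_sub_le` costs at most Qω²; every window therefore costs c₂ + Q. -/
theorem firstRemainder_le (hc : CoeffBounds μ σ M) (hM : 0 ≤ M) (hK : 0 ≤ K) (hL : 0 ≤ L)
    (hα : 1 / 3 < α) (hα2 : α ≤ 1 / 2) (hD : GridDriver α h K L N z a) (hε0 : 0 ≤ ε)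
    (hε : ε ≤ (2 + locC3 d d' α M K L)⁻¹) (hh : 3 * h ≤ delta d d' α M K L)
    (hadj : ∀ k < N, ‖remainder μ σ z a h y k (k + 1)‖ ≤ ε * h) {k l : ℕ} (hkl : k ≤ l)
    (hl : l ≤ N) :
    ‖firstRemainder μ σ z h y k l‖ ≤ constC2 d d' α M K L * (span h k l ^ α) ^ 2 := by
  have hα0 : 0 < α := by linarith
  have hC1 := (constC1_pos (d := d) (d' := d') hα hM hK hL).le
  have hc2 := (locC2_pos (d := d) (d' := d') (M := M) hL).le
  have hδ := delta_pos (d := d) (d' := d') hα hM hK hL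
  have hδ2 := delta_le_half (d := d) (d' := d') hα hα2 hM hK hL
  have hloc : ∀ k l, k ≤ l → l ≤ N → span h k l ≤ delta d d' α M K L →
      ‖firstRemainder μ σ z h y k l‖ ≤ locC2 d d' M L * (span h k l ^ α) ^ 2 :=
    fun k l hkl hl hs => firstRemainder_le_of_remainder_le hc hM hL hD hkl hl
      (local_remainder_le_sq hc hM hK hL hα hα2 hD hε0 hε hadj hkl hl hs)
  set Q := d * M * constC1 d d' α M K L + d * d' * M * K * constC1 d d' α M K L with hQ
  have hQ0 : 0 ≤ Q := by positivity
  have key : ∀ p : ℕ, ∀ k l, k ≤ l → l ≤ N → span h k l ≤ p * (2 * delta d d' α M K L / 3) →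
      ‖firstRemainder μ σ z h y k l‖ ≤ p * ((locC2 d d' M L + Q) * (span h k l ^ α) ^ 2) := by
    intro p
    induction p with
    | zero =>
      intro k l hkl hl hs
      obtain rfl := eq_of_span_nonpos hD.pos hkl (by simpa using hs)
      simp [firstRemainder_self]
    | succ p ih =>
      intro k l hkl hl hs
      have hω := hD.rpow_nonneg hkl
      have hcω : 0 ≤ locC2 d d' M L * (span h k l ^ α) ^ 2 := by positivity
      have hQω : 0 ≤ Q * (span h k l ^ α) ^ 2 := by positivity
      have hcωp : 0 ≤ p * ((locC2 d d' M L + Q) * (span h k l ^ α) ^ 2) := by positivity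
      push_cast at hs ⊢
      by_cases hsd : span h k l ≤ delta d d' α M K L
      · have := hloc k l hkl hl hsd
        linarith
      · obtain ⟨m, hkm, hml, hm1, hm2⟩ := exists_grid_step hD.pos hh (not_le.1 hsd)
        have h1 := hloc k m hkm (hml.trans hl) hm1
        have h2 := ih m l hml hl (by linarith [span_add_span h k m l])
        have g1 := hD.rpow_mono hα0.le (le_refl k) hkm hml
        have g2 := hD.rpow_mono hα0.le hkm hml (le_refl l)
        have n1 := hD.rpow_nonneg hkm
        have n2 := hD.rpow_nonneg hml
        have h1' : ‖firstRemainder μ σ z h y k m‖ ≤ locC2 d d' M L * (span h k l ^ α) ^ 2 :=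
          h1.trans (by gcongr)
        have h2' : ‖firstRemainder μ σ z h y m l‖
            ≤ p * ((locC2 d d' M L + Q) * (span h k l ^ α) ^ 2) := h2.trans (by gcongr)
        have hy : ‖y m - y k‖ ≤ constC1 d d' α M K L * span h k l ^ α :=
          (norm_sub_le hc hM hK hL hα hα2 hD hε0 hε hh hadj hkm (hml.trans hl)).trans (by gcongr)
        have h3 : ‖span h m l • (μ (y m) - μ (y k))
            + (linearTerm σ z m l (y m) - linearTerm σ z m l (y k))‖
              ≤ Q * (span h k l ^ α) ^ 2 := by
          refine (pi_norm_le_iff_of_nonneg hQω).2 fun i => ?_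
          rw [Real.norm_eq_abs]
          have w1 : span h m l ≤ span h k l ^ α := by
            have := hD.rpow_le_one hα0.le hml hl
            refine (hD.span_le_sq hα2 hml hl).trans (le_trans ?_ g2)
            nlinarith
          have t1 : |span h m l * (μ (y m) i - μ (y k) i)|
              ≤ span h k l ^ α * (d * M * (constC1 d d' α M K L * span h k l ^ α)) := by
            rw [abs_mul, abs_of_nonneg (span_nonneg hD.pos.le hml)]
            have := (hc.boundedDeriv_drift i).abs_sub_le hM (y m) (y k)
            have := this.trans (mul_le_mul_of_nonneg_left hy (by positivity))
            gcongr
          have t2 := abs_linearTerm_sub_le hc hM hD hml hl (y m) (y k) i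
          have t2' : d * d' * M * K * span h m l ^ α * ‖y m - y k‖
              ≤ d * d' * M * K * span h k l ^ α * (constC1 d d' α M K L * span h k l ^ α) := by
            gcongr
          refine (abs_add_le _ _).trans ((add_le_add t1 (t2.trans t2')).trans_eq ?_)
          rw [hQ]; ring
        have e : firstRemainder μ σ z h y k l = firstRemainder μ σ z h y k m
            + firstRemainder μ σ z h y m l + (span h m l • (μ (y m) - μ (y k))
            + (linearTerm σ z m l (y m) - linearTerm σ z m l (y k))) := by
          ext i
          simp only [firstRemainder, linearTerm, Pi.sub_apply, Pi.add_apply, Pi.smul_apply,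
            smul_eq_mul, ← span_add_span h k m l, mul_sub, Finset.sum_sub_distrib]
          ring
        rw [e]
        have := norm_add₃_le (a := firstRemainder μ σ z h y k m)
          (b := firstRemainder μ σ z h y m l) (c := span h m l • (μ (y m) - μ (y k))
            + (linearTerm σ z m l (y m) - linearTerm σ z m l (y k)))
        linarith
  have h1 := key ⌈3 / (2 * delta d d' α M K L)⌉₊ k l hkl hl
    ((hD.span_le_one hl).trans (one_le_natCeil_mul hδ))
  refine h1.trans ?_
  rw [constC2, mul_assoc, add_assoc, ← hQ]
  exact mul_le_mul_of_nonneg_right (natCeil_three_halves_div_le hδ hδ2) (by positivity)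

/-- With global bounds C₁ and C₂ at hand, sewing on all of [0,1] needs neither the induction
hypothesis in the split nor a short window. -/
theorem remainder_le (hc : CoeffBounds μ σ M) (hM : 0 ≤ M) (hK : 0 ≤ K) (hL : 0 ≤ L)
    (hα : 1 / 3 < α) (hα2 : α ≤ 1 / 2) (hD : GridDriver α h K L N z a) (hε0 : 0 ≤ ε)
    (hε : ε ≤ (2 + locC3 d d' α M K L)⁻¹) (hh : 3 * h ≤ delta d d' α M K L)
    (hadj : ∀ k < N, ‖remainder μ σ z a h y k (k + 1)‖ ≤ ε * h) {k l : ℕ} (hkl : k ≤ l)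
    (hl : l ≤ N) : ‖remainder μ σ z a h y k l‖
      ≤ constC3 d d' α M K L * (span h k l ^ α) ^ 3 + ε * span h k l := by
  have hα0 : 0 < α := by linarith
  have hC1 := (constC1_pos (d := d) (d' := d') hα hM hK hL).le
  have hC2 := (constC2_pos (d := d) (d' := d') hα hM hK hL).le
  refine grid_sewing (E := fun k l => ‖remainder μ σ z a h y k l‖) hα0.le hD.pos.le
    (constC3_nonneg hα hM hK hL)
    (kappa_nonneg hM hK hL hC1 hC2) (two_mul_eq_of_ratio hα _).le
    (fun k hk => by simp [remainder_self hα0 hD hk]) hadj ?_ hkl hl (hD.span_le_one hl)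
  intro k m l hkm hml hl _ _
  exact remainder_split_le hc hM hK hL hα0 hα2 hD hC1 hC2 hkm.le hml.le hl
    (norm_sub_le hc hM hK hL hα hα2 hD hε0 hε hh hadj hkm.le (hml.le.trans hl))
    (firstRemainder_le hc hM hK hL hα hα2 hD hε0 hε hh hadj hkm.le (hml.le.trans hl))

end Bounds

/-! ### Stability: the difference of two runs of the scheme -/

/-- The constant of the three-point recursion for the difference of two trajectories, given
constants `c₁`, `c₂` for the trajectories and `b₁`, `b₂` for their difference. -/
def diffKappa (d d' : ℕ) (M K L c₁ c₂ b₁ b₂ : ℝ) : ℝ :=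
  d' * K * (d ^ 3 * M * c₁ ^ 2 + d ^ 2 * M * c₁ * b₁ + d ^ 2 * M * (M + c₂) + d * M * b₂)
    + d' ^ 2 * L * (4 * d ^ 3 * M ^ 2 * c₁ + 2 * d ^ 2 * M ^ 2 * b₁)

/-- The increment of the difference of two sequences, minus the difference of the noise terms. -/
noncomputable def diffRemainder {d d' : ℕ} (σ : (Fin d → ℝ) → Fin d → Fin d' → ℝ)
    (z : ℕ → Fin d' → ℝ) (a : ℕ → ℕ → Fin d' → Fin d' → ℝ) (y y' : ℕ → Fin d → ℝ) (k l : ℕ) :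
    Fin d → ℝ :=
  (y l - y' l) - (y k - y' k) - (noise σ z a k l (y k) - noise σ z a k l (y' k))

section Stability

variable {d d' N : ℕ} {α h K L M : ℝ} {z : ℕ → Fin d' → ℝ} {a : ℕ → ℕ → Fin d' → Fin d' → ℝ}
  {μ : (Fin d → ℝ) → Fin d → ℝ} {σ : (Fin d → ℝ) → Fin d → Fin d' → ℝ} {y y' : ℕ → Fin d → ℝ}

/-- Subtracting the two instances of `noise_three_point` makes every term a difference along the two
trajectories, so each estimate keeps its cubic order and gains the factor `S`. -/
theorem noise_three_point_sub_le (hc : CoeffBounds μ σ M) (hM : 0 ≤ M) (hK : 0 ≤ K) (hL : 0 ≤ L)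
    (hα : 0 < α) (hα2 : α ≤ 1 / 2) (hD : GridDriver α h K L N z a) {c₁ c₂ b₁ b₂ S : ℝ}
    (hc₁ : 0 ≤ c₁) (hc₂ : 0 ≤ c₂) (hb₁ : 0 ≤ b₁) (hb₂ : 0 ≤ b₂) {k m l : ℕ}
    (hkm : k ≤ m) (hml : m ≤ l) (hl : l ≤ N) (hSk : ‖y k - y' k‖ ≤ S) (hSm : ‖y m - y' m‖ ≤ S)
    (h₁ : ‖y m - y k‖ ≤ c₁ * span h k m ^ α) (h₁' : ‖y' m - y' k‖ ≤ c₁ * span h k m ^ α)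
    (h₂ : ‖firstRemainder μ σ z h y' k m‖ ≤ c₂ * (span h k m ^ α) ^ 2)
    (h₃ : ‖(y m - y' m) - (y k - y' k)‖ ≤ b₁ * S * span h k m ^ α)
    (h₄ : ‖(y m - y' m) - (y k - y' k) - (linearTerm σ z k m (y k) - linearTerm σ z k m (y' k))‖
      ≤ b₂ * S * (span h k m ^ α) ^ 2) :
    ‖(noise σ z a k m (y k) + noise σ z a m l (y m) - noise σ z a k l (y k))
        - (noise σ z a k m (y' k) + noise σ z a m l (y' m) - noise σ z a k l (y' k))‖
      ≤ diffKappa d d' M K L c₁ c₂ b₁ b₂ * S * (span h k l ^ α) ^ 3 := by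
  have hS0 : 0 ≤ S := (norm_nonneg _).trans hSk
  have hω := hD.rpow_nonneg (hkm.trans hml)
  have hω1 := hD.rpow_nonneg hkm
  have hω2 := hD.rpow_nonneg hml
  have hm1 := hD.rpow_mono hα.le le_rfl hkm hml
  have hm2 := hD.rpow_mono hα.le hkm hml le_rfl
  have hs1 := hD.span_le_sq hα2 hkm (hml.trans hl)
  have hn1 := span_nonneg hD.pos.le hkm
  have hκ : 0 ≤ diffKappa d d' M K L c₁ c₂ b₁ b₂ := by unfold diffKappa; positivity
  refine (pi_norm_le_iff_of_nonneg (by positivity)).2 fun i => ?_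
  set W := span h k l ^ α with hW
  obtain ⟨u, hu⟩ : ∃ u, u = y m - y k := ⟨_, rfl⟩
  obtain ⟨u', hu'⟩ : ∃ u', u' = y' m - y' k := ⟨_, rfl⟩
  have hym : y m = y k + u := by rw [hu]; abel
  have hym' : y' m = y' k + u' := by rw [hu']; abel
  have huu : (y m - y' m) - (y k - y' k) = u - u' := by rw [hu, hu']; abel
  rw [← hu] at h₁
  rw [← hu'] at h₁'
  rw [huu] at h₃ h₄
  have k₁ : ‖u‖ ≤ c₁ * W := h₁.trans (by gcongr)
  have k₁' : ‖u'‖ ≤ c₁ * W := h₁'.trans (by gcongr)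
  have k₃ : ‖u - u'‖ ≤ b₁ * S * W := h₃.trans (by gcongr)
  have k₄ : ∀ p, |(u - u') p - (linearTerm σ z k m (y k) p - linearTerm σ z k m (y' k) p)|
      ≤ b₂ * S * W ^ 2 := fun p => (abs_apply_le_norm (u - u' -
        (linearTerm σ z k m (y k) - linearTerm σ z k m (y' k))) p).trans (h₄.trans (by gcongr))
  have k₂ : ∀ p, |u' p - linearTerm σ z k m (y' k) p| ≤ (M + c₂) * W ^ 2 := by
    intro p
    have e : u' p - linearTerm σ z k m (y' k) p
        = firstRemainder μ σ z h y' k m p + span h k m * μ (y' k) p := by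
      simp only [firstRemainder, ← hu', Pi.sub_apply, Pi.smul_apply, smul_eq_mul]; ring
    rw [e]
    have g1 : |span h k m * μ (y' k) p| ≤ W ^ 2 * M := by
      rw [abs_mul, abs_of_nonneg hn1]
      have := hc.drift_le (y' k) p
      have : span h k m ≤ W ^ 2 := hs1.trans (by gcongr)
      gcongr
    have g2 := (abs_apply_le_norm (firstRemainder μ σ z h y' k m) p).trans h₂
    have g3 : c₂ * (span h k m ^ α) ^ 2 ≤ c₂ * W ^ 2 := by gcongr
    refine (abs_add_le _ _).trans ?_
    linarith
  rw [hym, hym'] at hSm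
  simp only [Pi.sub_apply, Pi.add_apply]
  rw [noise_three_point hD hkm hml hl, noise_three_point hD hkm hml hl, hym, hym',
    add_sub_add_comm, ← Finset.sum_sub_distrib, Real.norm_eq_abs]
  simp only [← Finset.sum_sub_distrib, ← sub_mul]
  have t2 : |∑ j, (σ (y k + u) i j - σ (y k) i j
        - ∑ p, partialDeriv σ p i j (y k) * linearTerm σ z k m (y k) p
        - (σ (y' k + u') i j - σ (y' k) i j
        - ∑ p, partialDeriv σ p i j (y' k) * linearTerm σ z k m (y' k) p)) * (z l j - z m j)|
      ≤ d' * ((d ^ 3 * M * (c₁ * W) ^ 2 * S + d ^ 2 * M * (c₁ * W) * (b₁ * S * W)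
        + d * (d * M * S * ((M + c₂) * W ^ 2)) + d * (M * (b₂ * S * W ^ 2))) * (K * W)) := by
    refine abs_sum_mul_le (fun j => ?_) (by positivity) (fun j => ?_)
    · have hf := hc.boundedDeriv_diffusion i j
      -- With v = u - lin and v' = u' - lin', the part beyond the Taylor remainders is ∂σ(y)v -
      -- ∂σ(y')v' = (∂σ(y) - ∂σ(y'))v' + ∂σ(y)(v - v'); `g2` and `g3` bound the two products.
      have g1 := BoundedDeriv.abs_taylor_sub_le (k := 0) hM hf hSk hSm k₁ k₁' k₃
      have g2 := abs_sum_mul_le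
        (g := fun p => partialDeriv σ p i j (y k) - partialDeriv σ p i j (y' k))
        (v := fun p => u' p - linearTerm σ z k m (y' k) p) (P := d * M * S)
        (fun p => by
          rw [hc.pd_diffusion]
          exact ((hf.2.2 p).abs_sub_le hM _ _).trans
            (mul_le_mul_of_nonneg_left hSk (by positivity))) (by positivity) k₂
      have g3 := abs_sum_mul_le (g := fun p => partialDeriv σ p i j (y k))
        (v := fun p => (u - u') p
          - (linearTerm σ z k m (y k) p - linearTerm σ z k m (y' k) p)) (P := M)
        (fun p => by rw [hc.pd_diffusion]; exact (hf.2.2 p).abs_le _) hM k₄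
      refine le_trans (le_of_eq ?_) ((abs_add_le _ _).trans
        (add_le_add ((abs_add_le _ _).trans (add_le_add g1 g2)) g3))
      congr 1
      simp only [hc.pd_diffusion, Pi.sub_apply, mul_sub, sub_mul, Finset.sum_sub_distrib]
      ring
    · exact (hD.path_le m l hml hl j).trans (by gcongr)
  have t3 : |∑ j, ∑ p, ∑ q,
        (partialDeriv σ p i j (y k + u) * σ (y k + u) p q - partialDeriv σ p i j (y k) * σ (y k) p q
          - (partialDeriv σ p i j (y' k + u') * σ (y' k + u') p q
            - partialDeriv σ p i j (y' k) * σ (y' k) p q)) * a m l q j|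
      ≤ d * d' ^ 2 * ((4 * d ^ 2 * M ^ 2 * (c₁ * W) * S + 2 * d * M ^ 2 * (b₁ * S * W))
        * (L * W ^ 2)) := by
    refine abs_triple_sum_le fun j p q => ?_
    rw [abs_mul, hc.pd_diffusion]
    have g1 := BoundedDeriv.abs_mul_double_sub_le (k := 0) hM
      ((hc.boundedDeriv_diffusion i j).2.2 p)
      ((hc.boundedDeriv_diffusion p q).mono_succ) hSk hSm k₁ k₃
    have g2 : |a m l q j| ≤ L * W ^ 2 := (hD.area_le m l hml hl q j).trans (by gcongr)
    gcongr
  refine (abs_add_le _ _).trans ((add_le_add t2 t3).trans_eq ?_)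
  unfold diffKappa
  ring

/-- Smallness of bω reduces the cubic term to a square. Restoring the area differences then gives
`locB2`, and restoring the path differences as well gives `locB1`. -/
theorem diff_le_of_diffRemainder_le (hc : CoeffBounds μ σ M) (hM : 0 ≤ M) (hK : 0 ≤ K)
    (hL : 0 ≤ L) (hα2 : α ≤ 1 / 2) (hα : 0 < α) (hD : GridDriver α h K L N z a) {S b : ℝ}
    {k l : ℕ} (hkl : k ≤ l) (hl : l ≤ N) (hSk : ‖y k - y' k‖ ≤ S)
    (hb : b * span h k l ^ α ≤ 1)
    (hF : ‖diffRemainder σ z a y y' k l‖ ≤ b * S * (span h k l ^ α) ^ 3 + d * M * S * span h k l) :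
    ‖(y l - y' l) - (y k - y' k) - (linearTerm σ z k l (y k) - linearTerm σ z k l (y' k))‖
        ≤ locB2 d d' M L * S * (span h k l ^ α) ^ 2 ∧
      ‖(y l - y' l) - (y k - y' k)‖ ≤ locB1 d d' M K L * S * span h k l ^ α := by
  have hS0 : 0 ≤ S := (norm_nonneg _).trans hSk
  have hω := hD.rpow_nonneg hkl
  have hω1 := hD.rpow_le_one hα.le hkl hl
  have hs := hD.span_le_sq hα2 hkl hl
  set W := span h k l ^ α with hW
  have hB2 : 0 ≤ locB2 d d' M L := by unfold locB2; positivity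
  have hB1 : 0 ≤ locB1 d d' M K L := by unfold locB1; positivity
  have hF' : ‖diffRemainder σ z a y y' k l‖ ≤ (1 + d * M) * S * W ^ 2 := by
    refine hF.trans ?_
    have g1 : b * W * (S * W ^ 2) ≤ 1 * (S * W ^ 2) := by gcongr
    have g2 : d * M * S * span h k l ≤ d * M * S * W ^ 2 := by gcongr
    linarith
  have key : ∀ i, |((y l - y' l) - (y k - y' k)
      - (linearTerm σ z k l (y k) - linearTerm σ z k l (y' k))) i|
        ≤ locB2 d d' M L * S * W ^ 2 := by
    intro i
    have e : ((y l - y' l) - (y k - y' k)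
        - (linearTerm σ z k l (y k) - linearTerm σ z k l (y' k))) i
        = diffRemainder σ z a y y' k l i
          + (areaTerm σ a k l (y k) i - areaTerm σ a k l (y' k) i) := by
      simp only [diffRemainder, noise, Pi.sub_apply, Pi.add_apply]; ring
    rw [e]
    have g1 := (abs_apply_le_norm _ i).trans hF'
    have g2 := (abs_areaTerm_sub_le hc hM hD hkl hl (y k) (y' k) i).trans
      (mul_le_mul_of_nonneg_left hSk (by positivity))
    refine (abs_add_le _ _).trans ((add_le_add g1 g2).trans_eq ?_)
    unfold locB2; ring
  refine ⟨(pi_norm_le_iff_of_nonneg (by positivity)).2 key,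
    (pi_norm_le_iff_of_nonneg (by positivity)).2 fun i => ?_⟩
  have g1 := key i
  have g2 := (abs_linearTerm_sub_le hc hM hD hkl hl (y k) (y' k) i).trans
      (mul_le_mul_of_nonneg_left hSk (by positivity))
  have g3 : locB2 d d' M L * S * W ^ 2 ≤ locB2 d d' M L * S * W := by
    have : W ^ 2 ≤ W := by nlinarith
    gcongr
  have e : ((y l - y' l) - (y k - y' k)) i = ((y l - y' l) - (y k - y' k)
        - (linearTerm σ z k l (y k) - linearTerm σ z k l (y' k))) i
        + (linearTerm σ z k l (y k) i - linearTerm σ z k l (y' k) i) := by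
    simp only [Pi.sub_apply]; ring
  rw [e, Real.norm_eq_abs]
  refine (abs_add_le _ _).trans ((add_le_add (g1.trans g3) g2).trans_eq ?_)
  unfold locB1 locB2; ring

theorem locB3_nonneg (hα : 1 / 3 < α) (hM : 0 ≤ M) (hK : 0 ≤ K) (hL : 0 ≤ L) :
    0 ≤ locB3 d d' α M K L := by
  have h1 := (constC1_pos (d := d) (d' := d') hα hM hK hL).le
  have h2 := (constC2_pos (d := d) (d' := d') hα hM hK hL).le
  have h3 := one_sub_two_rpow_pos hα
  have hB2 : 0 ≤ locB2 d d' M L := by unfold locB2; positivity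
  have hB1 : 0 ≤ locB1 d d' M K L := by unfold locB1; positivity
  unfold locB3
  positivity

/-- The same bootstrap, relative to a bound `S` on the difference. Only one derivative of `μ` is
bounded, so its double differences are not available; the drift is therefore kept out of
`diffRemainder` and enters through single cells, where it contributes at most dMS·h, i.e. the sewing
parameter ε = dMS. -/
theorem window_diff_le (hc : CoeffBounds μ σ M) (hM : 0 ≤ M) (hK : 0 ≤ K) (hL : 0 ≤ L)
    (hα : 1 / 3 < α) (hα2 : α ≤ 1 / 2) (hD : GridDriver α h K L N z a)
    (hh : 3 * h ≤ delta d d' α M K L) (hy : ∀ k < N, remainder μ σ z a h y k (k + 1) = 0)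
    (hy' : ∀ k < N, remainder μ σ z a h y' k (k + 1) = 0) {S : ℝ}
    (hS : ∀ k ≤ N, ‖y k - y' k‖ ≤ S) {k l : ℕ} (hkl : k ≤ l) (hl : l ≤ N)
    (hδ : span h k l ≤ delta' d d' α M K L) :
    ‖(y l - y' l) - (y k - y' k)‖ ≤ locB1 d d' M K L * S * span h k l ^ α := by
  have hα0 : 0 < α := by linarith
  have hS0 : 0 ≤ S := (norm_nonneg _).trans (hS 0 (Nat.zero_le _))
  have hB3 := locB3_nonneg (d := d) (d' := d') hα hM hK hL
  have hB2 : 0 ≤ locB2 d d' M L := by unfold locB2; positivity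
  have hB1 : 0 ≤ locB1 d d' M K L := by unfold locB1; positivity
  have hC1 := (constC1_pos (d := d) (d' := d') hα hM hK hL).le
  have hC2 := (constC2_pos (d := d) (d' := d') hα hM hK hL).le
  have hε : (0 : ℝ) ≤ (2 + locC3 d d' α M K L)⁻¹ :=
    inv_nonneg.2 (by linarith [locC3_nonneg (d := d) (d' := d') hα hM hK hL])
  have ha : ∀ k < N, ‖remainder μ σ z a h y k (k + 1)‖ ≤ 0 * h := fun k hk => by simp [hy k hk]
  have ha' : ∀ k < N, ‖remainder μ σ z a h y' k (k + 1)‖ ≤ 0 * h := fun k hk => by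
    simp [hy' k hk]
  have small : ∀ k l, k ≤ l → span h k l ≤ delta' d d' α M K L →
      locB3 d d' α M K L * span h k l ^ α ≤ 1 := by
    intro k l hkl hs
    have := rpow_le_inv_of_le hα0 (by linarith) (span_nonneg hD.pos.le hkl) hs
    refine (mul_le_mul_of_nonneg_left this hB3).trans ?_
    rw [mul_inv_le_iff₀ (by linarith)]
    linarith
  have hκ : 0 ≤ diffKappa d d' M K L (constC1 d d' α M K L) (constC2 d d' α M K L)
      (locB1 d d' M K L) (locB2 d d' M L) := by unfold diffKappa; positivity
  have main := grid_sewing (E := fun k l => ‖diffRemainder σ z a y y' k l‖) (N := N)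
    (k := k) (l := l)
    (c := locB3 d d' α M K L * S) (κ := diffKappa d d' M K L (constC1 d d' α M K L)
      (constC2 d d' α M K L) (locB1 d d' M K L) (locB2 d d' M L) * S) (ε := d * M * S)
    (δ := delta' d d' α M K L) hα0.le hD.pos.le (by positivity) (by positivity)
    (by
      have := two_mul_eq_of_ratio hα (diffKappa d d' M K L (constC1 d d' α M K L)
        (constC2 d d' α M K L) (locB1 d d' M K L) (locB2 d d' M L))
      rw [← mul_assoc, ← mul_assoc, this]
      exact le_rfl)
    (fun k hk => by
      have : diffRemainder σ z a y y' k k = 0 := by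
        ext i
        simp [diffRemainder, noise, linearTerm, areaTerm, hD.area_self hα0 hk]
      simp [this])
    (fun k hk => by
      have e : diffRemainder σ z a y y' k (k + 1) = h • (μ (y k) - μ (y' k)) := by
        have e1 := hy k hk
        have e2 := hy' k hk
        simp only [remainder, gridIncrement, span_succ, sub_eq_zero] at e1 e2
        have e3 : diffRemainder σ z a y y' k (k + 1) = (y (k + 1) - y k) - (y' (k + 1) - y' k)
            - (noise σ z a k (k + 1) (y k) - noise σ z a k (k + 1) (y' k)) := by
          unfold diffRemainder; abel
        rw [e3, e1, e2, smul_sub]; abel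
      have := hD.pos
      refine (pi_norm_le_iff_of_nonneg (by positivity)).2 fun i => ?_
      rw [e, Pi.smul_apply, Pi.sub_apply, smul_eq_mul, Real.norm_eq_abs, abs_mul,
        abs_of_pos this, mul_comm]
      exact mul_le_mul_of_nonneg_right (((hc.boundedDeriv_drift i).abs_sub_le hM _ _).trans
        (mul_le_mul_of_nonneg_left (hS k hk.le) (by positivity))) this.le)
    (fun k m l hkm hml hl hs IH => by
      have hm := hml.le.trans hl
      have hsm := (span_mono hD.pos.le (le_refl k) hml.le).trans hs
      obtain ⟨g1, g2⟩ := diff_le_of_diffRemainder_le hc hM hK hL hα2 hα0 hD hkm.le hm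
        (hS k (hkm.le.trans hm)) (small k m hkm.le hsm) (IH k m le_rfl hkm.le hml.le (by omega))
      have e : diffRemainder σ z a y y' k l = diffRemainder σ z a y y' k m
          + diffRemainder σ z a y y' m l
          + ((noise σ z a k m (y k) + noise σ z a m l (y m) - noise σ z a k l (y k))
            - (noise σ z a k m (y' k) + noise σ z a m l (y' m) - noise σ z a k l (y' k))) := by
        unfold diffRemainder; abel
      rw [e]
      exact (norm_add_le _ _).trans (add_le_add (norm_add_le _ _)
        (noise_three_point_sub_le hc hM hK hL hα0 hα2 hD hC1 hC2 hB1 hB2 hkm.le hml.le hl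
          (hS k (hkm.le.trans hm)) (hS m hm)
          (norm_sub_le hc hM hK hL hα hα2 hD le_rfl hε hh ha hkm.le hm)
          (norm_sub_le hc hM hK hL hα hα2 hD le_rfl hε hh ha' hkm.le hm)
          (firstRemainder_le hc hM hK hL hα hα2 hD le_rfl hε hh ha' hkm.le hm) g2 g1)))
    hkl hl hδ
  exact (diff_le_of_diffRemainder_le hc hM hK hL hα2 hα0 hD hkl hl (hS k (hkl.trans hl))
    (small k l hkl hδ) main).2

/-- Take `S` to be the maximum over the window, attained at `m`. The term 2b₁ in `delta'` makes the
growth up to `m` at most S/2, which is absorbed: S is at most twice the initial difference. -/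
theorem window_norm_le (hc : CoeffBounds μ σ M) (hM : 0 ≤ M) (hK : 0 ≤ K) (hL : 0 ≤ L)
    (hα : 1 / 3 < α) (hα2 : α ≤ 1 / 2) (hD : GridDriver α h K L N z a)
    (hh : 3 * h ≤ delta d d' α M K L) (hy : ∀ k < N, remainder μ σ z a h y k (k + 1) = 0)
    (hy' : ∀ k < N, remainder μ σ z a h y' k (k + 1) = 0)
    (hδ : span h 0 N ≤ delta' d d' α M K L) : ‖y N - y' N‖ ≤ 2 * ‖y 0 - y' 0‖ := by
  have hα0 : 0 < α := by linarith
  obtain ⟨m, hm, hmax⟩ := Finset.exists_max_image (Finset.range (N + 1)) (fun i => ‖y i - y' i‖)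
    ⟨0, by simp⟩
  have hmN : m ≤ N := Nat.lt_succ_iff.1 (Finset.mem_range.1 hm)
  have hS : ∀ k ≤ N, ‖y k - y' k‖ ≤ ‖y m - y' m‖ := fun k hk =>
    hmax k (Finset.mem_range.2 (Nat.lt_succ_iff.2 hk))
  have hs := (span_mono hD.pos.le (le_refl 0) hmN).trans hδ
  have h1 := window_diff_le hc hM hK hL hα hα2 hD hh hy hy' hS (Nat.zero_le m) hmN hs
  have hB3 := locB3_nonneg (d := d) (d' := d') hα hM hK hL
  have hB1 : 0 ≤ locB1 d d' M K L := by unfold locB1; positivity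
  have h2 : locB1 d d' M K L * span h 0 m ^ α ≤ 1 / 2 := by
    have := rpow_le_inv_of_le hα0 (by linarith) (span_nonneg hD.pos.le (Nat.zero_le m)) hs
    refine (mul_le_mul_of_nonneg_left this hB1).trans ?_
    rw [mul_inv_le_iff₀ (by linarith)]
    linarith
  have h3 := mul_le_mul_of_nonneg_right h2 (norm_nonneg (y m - y' m))
  have h4 := norm_add_le ((y m - y' m) - (y 0 - y' 0)) (y 0 - y' 0)
  rw [sub_add_cancel] at h4
  have := hS N le_rfl
  linarith

theorem remainder_shift (p k l : ℕ) :
    remainder μ σ (fun k => z (p + k)) (fun k l => a (p + k) (p + l)) h (fun k => y (p + k)) k l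
      = remainder μ σ z a h y (p + k) (p + l) := by
  simp only [remainder, gridIncrement, span_shift]
  rfl

theorem GridDriver.truncate (hD : GridDriver α h K L N z a) {n : ℕ} (hn : n ≤ N) :
    GridDriver α h K L n z a where
  pos := hD.pos
  le_one := (mul_le_mul_of_nonneg_right (Nat.cast_le.2 hn) hD.pos.le).trans hD.le_one
  chen k m l h1 h2 h3 := hD.chen k m l h1 h2 (h3.trans hn)
  path_le k l h1 h2 := hD.path_le k l h1 (h2.trans hn)
  area_le k l h1 h2 := hD.area_le k l h1 (h2.trans hn)

theorem delta'_pos (hα : 1 / 3 < α) (hM : 0 ≤ M) (hK : 0 ≤ K) (hL : 0 ≤ L) :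
    0 < delta' d d' α M K L := by
  have hB3 := locB3_nonneg (d := d) (d' := d') hα hM hK hL
  have hB1 : 0 ≤ locB1 d d' M K L := by unfold locB1; positivity
  exact Real.rpow_pos_of_pos (by linarith) _

theorem delta'_le_half (hα : 1 / 3 < α) (hα2 : α ≤ 1 / 2) (hM : 0 ≤ M) (hK : 0 ≤ K) (hL : 0 ≤ L) :
    delta' d d' α M K L ≤ 1 / 2 := by
  have hB3 := locB3_nonneg (d := d) (d' := d') hα hM hK hL
  have hB1 : 0 ≤ locB1 d d' M K L := by unfold locB1; positivity
  exact rpow_neg_one_div_le_half (by linarith) (by linarith) (by linarith)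

/-- The scheme depends on its initial value in a Lipschitz way, uniformly in the mesh. -/
theorem norm_sub_scheme_le (hc : CoeffBounds μ σ M) (hM : 0 ≤ M) (hK : 0 ≤ K) (hL : 0 ≤ L)
    (hα : 1 / 3 < α) (hα2 : α ≤ 1 / 2) (hD : GridDriver α h K L N z a)
    (hh : 3 * h ≤ delta d d' α M K L) (hh' : 3 * h ≤ delta' d d' α M K L)
    (hy : ∀ k < N, remainder μ σ z a h y k (k + 1) = 0)
    (hy' : ∀ k < N, remainder μ σ z a h y' k (k + 1) = 0) {l : ℕ} (hl : l ≤ N) :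
    ‖y l - y' l‖ ≤ 2 ^ (2 / delta' d d' α M K L) * ‖y 0 - y' 0‖ := by
  have hδ := delta'_pos (d := d) (d' := d') hα hM hK hL
  have hδ2 := delta'_le_half (d := d) (d' := d') hα hα2 hM hK hL
  have hloc : ∀ k l, k ≤ l → l ≤ N → span h k l ≤ delta' d d' α M K L →
      ‖y l - y' l‖ ≤ 2 * ‖y k - y' k‖ := by
    intro k l hkl hl hs
    -- The window estimate starts at index 0, so the grid is shifted to begin at `k` and cut off at
    -- `l`.
    have := window_norm_le (y := fun i => y (k + i)) (y' := fun i => y' (k + i)) hc hM hK hL hα hα2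
      ((hD.shift k (hkl.trans hl)).truncate (Nat.sub_le_sub_right hl k)) hh
      (fun i hi => by rw [remainder_shift]; exact hy (k + i) (by omega))
      (fun i hi => by rw [remainder_shift]; exact hy' (k + i) (by omega))
      (by rw [← span_shift h k, Nat.add_sub_cancel' hkl]; exact hs)
    simpa [Nat.add_sub_cancel' hkl] using this
  have key : ∀ p : ℕ, ∀ k l, k ≤ l → l ≤ N → span h k l ≤ p * (2 * delta' d d' α M K L / 3) →
      ‖y l - y' l‖ ≤ 2 ^ p * ‖y k - y' k‖ := by
    intro p
    induction p with
    | zero =>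
      intro k l hkl hl hs
      obtain rfl := eq_of_span_nonpos hD.pos hkl (by simpa using hs)
      simp
    | succ p ih =>
      intro k l hkl hl hs
      push_cast at hs
      by_cases hsd : span h k l ≤ delta' d d' α M K L
      · refine (hloc k l hkl hl hsd).trans ?_
        gcongr
        exact le_self_pow₀ one_le_two (Nat.succ_ne_zero p)
      · obtain ⟨m, hkm, hml, hm1, hm2⟩ := exists_grid_step hD.pos hh' (not_le.1 hsd)
        have h1 := hloc k m hkm (hml.trans hl) hm1
        have h2 := ih m l hml hl (by linarith [span_add_span h k m l])
        calc ‖y l - y' l‖ ≤ 2 ^ p * (2 * ‖y k - y' k‖) := h2.trans (by gcongr)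
          _ = _ := by ring
  have h1 := key ⌈3 / (2 * delta' d d' α M K L)⌉₊ 0 l (Nat.zero_le l) hl
    ((hD.span_le_one hl).trans (one_le_natCeil_mul hδ))
  refine h1.trans (mul_le_mul_of_nonneg_right ?_ (norm_nonneg _))
  rw [← Real.rpow_natCast]
  exact Real.rpow_le_rpow_of_exponent_le one_le_two (natCeil_three_halves_div_le hδ hδ2)

end Stability

/-! ### From continuous time to grids -/

section Sample

variable {d d' N : ℕ} {α h K L M t₀ : ℝ} {Z : ℝ → Fin d' → ℝ} {A : ℝ → ℝ → Fin d' → Fin d' → ℝ}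
  {μ : (Fin d → ℝ) → Fin d → ℝ} {σ : (Fin d → ℝ) → Fin d → Fin d' → ℝ}

/-- The values of the path along the grid `t₀, t₀ + h, …`. -/
def samplePath (Z : ℝ → Fin d' → ℝ) (t₀ h : ℝ) (k : ℕ) : Fin d' → ℝ := Z (t₀ + k * h)

/-- The areas between the points of the grid `t₀, t₀ + h, …`. -/
def sampleArea (A : ℝ → ℝ → Fin d' → Fin d' → ℝ) (t₀ h : ℝ) (k l : ℕ) : Fin d' → Fin d' → ℝ :=
  if k < l then A (t₀ + k * h) (t₀ + l * h) else 0

theorem abs_path_sub_le (hK : 0 ≤ K) (hZ : pathNorm α Z ≤ ENNReal.ofReal K) {s t : ℝ} (hs : 0 ≤ s)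
    (hst : s < t) (ht : t ≤ 1) (i : Fin d') : |Z t i - Z s i| ≤ K * (t - s) ^ α := by
  simp only [pathNorm, iSup_le_iff] at hZ
  have h1 := (ENNReal.ofReal_le_ofReal_iff hK).1 (hZ s t hs hst ht)
  rw [div_le_iff₀ (Real.rpow_pos_of_pos (sub_pos.2 hst) α)] at h1
  exact (norm_le_pi_norm (Z t - Z s) i).trans h1

theorem abs_area_le (hL : 0 ≤ L) (hA : areaNorm α A ≤ ENNReal.ofReal L) {s t : ℝ} (hs : 0 ≤ s)
    (hst : s < t) (ht : t ≤ 1) (i j : Fin d') : |A s t i j| ≤ L * ((t - s) ^ α) ^ 2 := by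
  simp only [areaNorm, iSup_le_iff] at hA
  have h1 := (ENNReal.ofReal_le_ofReal_iff hL).1 (hA s t hs hst ht i j)
  rw [div_le_iff₀ (Real.rpow_pos_of_pos (sub_pos.2 hst) _), mul_comm 2 α,
    Real.rpow_mul (sub_pos.2 hst).le] at h1
  exact_mod_cast h1

theorem sub_eq_span (t₀ h : ℝ) (k l : ℕ) : t₀ + l * h - (t₀ + k * h) = span h k l := by
  simp only [span]; ring

/-- The relations for `A` concern only s < t. On the diagonal `sampleArea` is zero, which is what
the degenerate cases of Chen's relation require. -/
theorem gridDriver_sample (hα : 0 < α) (hK : 0 ≤ K) (hL : 0 ≤ L)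
    (hZ : pathNorm α Z ≤ ENNReal.ofReal K) (hA : areaNorm α A ≤ ENNReal.ofReal L)
    (hZA : IsArea Z A) (hh : 0 < h) (ht₀ : 0 ≤ t₀) (hN : t₀ + N * h ≤ 1) :
    GridDriver α h K L N (samplePath Z t₀ h) (sampleArea A t₀ h) := by
  have hlt : ∀ {k l : ℕ}, k < l → t₀ + k * h < t₀ + l * h := fun hkl => by gcongr
  have hle : ∀ {l : ℕ}, l ≤ N → t₀ + l * h ≤ 1 := fun hl =>
    le_trans (by gcongr) hN
  have hnn : ∀ k : ℕ, 0 ≤ t₀ + k * h := fun k => by positivity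
  refine ⟨hh, by linarith, fun k m l hkm hml hl i j => ?_, fun k l hkl hl i => ?_,
    fun k l hkl hl i j => ?_⟩
  · obtain rfl | hkm := hkm.eq_or_lt
    · simp [sampleArea]
    obtain rfl | hml := hml.eq_or_lt
    · simp [sampleArea]
    simp only [sampleArea, samplePath, if_pos hkm, if_pos hml, if_pos (hkm.trans hml)]
    exact hZA _ _ _ (hnn k) (hlt hkm) (hlt hml) (hle hl) i j
  · obtain rfl | hkl := hkl.eq_or_lt
    · rw [span_self, Real.zero_rpow hα.ne']; simp
    rw [← sub_eq_span t₀]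
    exact abs_path_sub_le hK hZ (hnn k) (hlt hkl) (hle hl) i
  · obtain rfl | hkl := hkl.eq_or_lt
    · rw [span_self, Real.zero_rpow hα.ne']; simp [sampleArea]
    rw [← sub_eq_span t₀]
    simp only [sampleArea, if_pos hkl]
    exact abs_area_le hL hA (hnn k) (hlt hkl) (hle hl) i j

theorem gridIncrement_sample {k l : ℕ} (hkl : k < l) (x : Fin d → ℝ) :
    gridIncrement μ σ (samplePath Z t₀ h) (sampleArea A t₀ h) h k l x
      = increment μ σ Z A (t₀ + k * h) (t₀ + l * h) x := by
  ext i
  simp only [gridIncrement, noise, linearTerm, areaTerm, increment, Pi.add_apply, Pi.smul_apply,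
    smul_eq_mul, sub_eq_span, samplePath, sampleArea, if_pos hkl]
  ring

theorem norm_increment_le (hc : CoeffBounds μ σ M) (hM : 0 ≤ M) (hK : 0 ≤ K) (hL : 0 ≤ L)
    (hα : 0 < α) (hα2 : α ≤ 1 / 2) (hZ : pathNorm α Z ≤ ENNReal.ofReal K)
    (hA : areaNorm α A ≤ ENNReal.ofReal L) (hZA : IsArea Z A) {s t : ℝ} (hs : 0 ≤ s) (hst : s < t)
    (ht : t ≤ 1) (x : Fin d → ℝ) : ‖increment μ σ Z A s t x‖
      ≤ (M + d' * M * K + d * d' ^ 2 * M ^ 2 * L) * (t - s) ^ α := by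
  -- The interval [s,t] is viewed as a grid with a single cell.
  have hD := gridDriver_sample (N := 1) hα hK hL hZ hA hZA (sub_pos.2 hst) hs
    (by push_cast; linarith)
  have e := gridIncrement_sample (μ := μ) (σ := σ) (Z := Z) (A := A) (t₀ := s) (h := t - s)
    zero_lt_one x
  rw [Nat.cast_zero, Nat.cast_one, zero_mul, one_mul, add_zero, add_sub_cancel] at e
  have hω := Real.rpow_nonneg (sub_pos.2 hst).le α
  have hω1 := Real.rpow_le_one (sub_pos.2 hst).le (by linarith : t - s ≤ 1) hα.le
  have hsq : ((t - s) ^ α) ^ 2 ≤ (t - s) ^ α := by nlinarith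
  have hsp : span (t - s) 0 1 = t - s := span_succ (k := 0)
  refine (pi_norm_le_iff_of_nonneg (by positivity)).2 fun i => ?_
  have h1 := abs_linearTerm_le hc hM hD zero_le_one le_rfl x i
  have h2 := abs_areaTerm_le hc hM hD zero_le_one le_rfl x i
  rw [hsp] at h1 h2
  have h2' : d * d' ^ 2 * M ^ 2 * L * ((t - s) ^ α) ^ 2 ≤ d * d' ^ 2 * M ^ 2 * L * (t - s) ^ α := by
    gcongr
  have h3 : |(t - s) * μ x i| ≤ (t - s) ^ α * M := by
    rw [abs_mul, abs_of_pos (sub_pos.2 hst)]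
    exact mul_le_mul ((le_rpow_sq (sub_pos.2 hst).le (by linarith) hα2).trans hsq)
      (hc.drift_le x i) (abs_nonneg _) hω
  rw [← e, gridIncrement, noise, Real.norm_eq_abs, hsp]
  simp only [Pi.add_apply, Pi.smul_apply, smul_eq_mul]
  refine (abs_add_le _ _).trans ((add_le_add h3 ((abs_add_le _ _).trans
    (add_le_add h1 (h2.trans h2')))).trans_eq ?_)
  ring

/-- On a fine grid of [s,t] the expansion makes every one-cell remainder at most εh, and
`remainder_le` leaves C₃(t-s)^(3α) + ε(t-s), with C₃ independent of the grid. Then ε tends to zero.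
-/
theorem IsSolution.norm_remainder_le (hc : CoeffBounds μ σ M) (hM : 0 ≤ M) (hK : 0 ≤ K)
    (hL : 0 ≤ L) (hα : 1 / 3 < α) (hα2 : α ≤ 1 / 2) (hZ : pathNorm α Z ≤ ENNReal.ofReal K)
    (hA : areaNorm α A ≤ ENNReal.ofReal L) {x₀ : Fin d → ℝ} {X : ℝ → Fin d → ℝ}
    (hX : IsSolution μ σ Z A x₀ X) {s t : ℝ} (hs : 0 ≤ s) (hst : s < t) (ht : t ≤ 1) :
    ‖X t - X s - increment μ σ Z A s t (X s)‖ ≤ constC3 d d' α M K L * ((t - s) ^ α) ^ 3 := by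
  have hα0 : 0 < α := by linarith
  have hε₀ : 0 < (2 + locC3 d d' α M K L)⁻¹ :=
    inv_pos.2 (by linarith [locC3_nonneg (d := d) (d' := d') hα hM hK hL])
  have hdel := delta_pos (d := d) (d' := d') hα hM hK hL
  refine le_of_forall_pos_le_add fun ε' hε' => ?_
  -- The cap (2+c₃)⁻¹ is the threshold on ε in the a priori bounds.
  obtain ⟨ε, hεe⟩ : ∃ ε, ε = min ε' (2 + locC3 d d' α M K L)⁻¹ := ⟨_, rfl⟩
  have hε : 0 < ε := hεe ▸ lt_min hε' hε₀
  have hε1 : ε ≤ ε' := hεe ▸ min_le_left _ _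
  have hε2 : ε ≤ (2 + locC3 d d' α M K L)⁻¹ := hεe ▸ min_le_right _ _
  obtain ⟨η, hη, hexp⟩ := hX.expansion ε hε
  obtain ⟨N, hN⟩ := exists_nat_gt ((t - s) / min η (delta d d' α M K L / 3))
  have hmin : 0 < min η (delta d d' α M K L / 3) := lt_min hη (by positivity)
  have hN0 : (0 : ℝ) < N := (div_pos (sub_pos.2 hst) hmin).trans hN
  obtain ⟨h, hh⟩ : ∃ h, h = (t - s) / N := ⟨_, rfl⟩
  have hNh : N * h = t - s := by rw [hh]; field_simp
  have hpos : 0 < h := hh ▸ div_pos (sub_pos.2 hst) hN0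
  have hlt : h < min η (delta d d' α M K L / 3) := by
    rw [hh, div_lt_iff₀ hN0]
    rw [div_lt_iff₀ hmin] at hN
    linarith
  have hD := gridDriver_sample (N := N) hα0 hK hL hZ hA hX.area hpos hs (by linarith)
  have hsN : s + N * h = t := by linarith
  have hNpos : 0 < N := by exact_mod_cast hN0
  have key := remainder_le (y := fun k => X (s + k * h)) hc hM hK hL hα hα2 hD hε.le hε2
    (by linarith [min_le_right η (delta d d' α M K L / 3)])
    (fun k hk => by
      refine (pi_norm_le_iff_of_nonneg (by positivity)).2 fun i => ?_
      rw [remainder, gridIncrement_sample (Nat.lt_succ_self k)]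
      have hsp : s + ((k + 1 : ℕ) : ℝ) * h - (s + k * h) = h := by push_cast; ring
      have h1 : s + ((k + 1 : ℕ) : ℝ) * h ≤ 1 := by
        have : ((k + 1 : ℕ) : ℝ) ≤ N := Nat.cast_le.2 hk
        have := mul_le_mul_of_nonneg_right this hpos.le
        linarith
      have := hexp (s + k * h) (s + ((k + 1 : ℕ) : ℝ) * h) (by positivity) (by linarith) h1
        (by rw [hsp]; exact hlt.trans_le (min_le_left _ _)) i
      rw [hsp] at this
      exact this)
    (Nat.zero_le N) le_rfl
  rw [remainder, gridIncrement_sample hNpos, ← sub_eq_span s h] at key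
  simp only [Nat.cast_zero, zero_mul, add_zero, hsN] at key
  refine key.trans ?_
  have : ε * (t - s) ≤ ε' := (mul_le_of_le_one_right hε.le (by linarith)).trans hε1
  linarith

end Sample

/-! ### Propagation of local errors -/

section Telescope

variable {d d' N : ℕ} {α h K L M : ℝ} {z : ℕ → Fin d' → ℝ} {a : ℕ → ℕ → Fin d' → Fin d' → ℝ}
  {μ : (Fin d → ℝ) → Fin d → ℝ} {σ : (Fin d → ℝ) → Fin d → Fin d' → ℝ}

/-- The scheme started at the grid point with index `p` from the state `x`, after `j` steps. -/
noncomputable def flow (μ : (Fin d → ℝ) → Fin d → ℝ) (σ : (Fin d → ℝ) → Fin d → Fin d' → ℝ)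
    (z : ℕ → Fin d' → ℝ) (a : ℕ → ℕ → Fin d' → Fin d' → ℝ) (h : ℝ) (p : ℕ) (x : Fin d → ℝ) :
    ℕ → Fin d → ℝ
  | 0 => x
  | j + 1 => flow μ σ z a h p x j
      + gridIncrement μ σ z a h (p + j) (p + j + 1) (flow μ σ z a h p x j)

theorem gridIncrement_shift (p k l : ℕ) (x : Fin d → ℝ) :
    gridIncrement μ σ (fun k => z (p + k)) (fun k l => a (p + k) (p + l)) h k l x
      = gridIncrement μ σ z a h (p + k) (p + l) x := by
  simp only [gridIncrement, span_shift]
  rfl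

/-- Compare the run from x p with the run restarted from x (p+1): they differ by one local error at
index p+1, which stability carries forward with a uniform factor. Induction handles the restarted
run, so the errors add instead of compounding. -/
theorem norm_flow_sub_le (hc : CoeffBounds μ σ M) (hM : 0 ≤ M) (hK : 0 ≤ K) (hL : 0 ≤ L)
    (hα : 1 / 3 < α) (hα2 : α ≤ 1 / 2) (hD : GridDriver α h K L N z a)
    (hh : 3 * h ≤ delta d d' α M K L) (hh' : 3 * h ≤ delta' d d' α M K L) {x : ℕ → Fin d → ℝ}
    {η : ℝ} (hx : ∀ k < N, ‖remainder μ σ z a h x k (k + 1)‖ ≤ η) (j p : ℕ) (hpj : p + j ≤ N) :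
    ‖flow μ σ z a h p (x p) j - x (p + j)‖
      ≤ j * (2 ^ (2 / delta' d d' α M K L) * η) := by
  induction j generalizing p with
  | zero => simp [flow]
  | succ j ih =>
    have h1 := ih (p + 1) (by omega)
    have hidx : ∀ i, p + 1 + i = p + (i + 1) := fun i => by omega
    have h2 := norm_sub_scheme_le (y := fun i => flow μ σ z a h p (x p) (i + 1))
      (y' := flow μ σ z a h (p + 1) (x (p + 1))) (l := j) hc hM hK hL hα hα2
      (hD.shift (p + 1) (by omega)) hh hh'
      (fun i _ => by
        rw [remainder, gridIncrement_shift, hidx, hidx, flow, add_sub_cancel_left, sub_eq_zero]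
        rfl)
      (fun i _ => by
        rw [remainder, gridIncrement_shift, flow, add_sub_cancel_left, sub_eq_zero]
        rfl) (by omega)
    have h3 : ‖flow μ σ z a h p (x p) (0 + 1) - flow μ σ z a h (p + 1) (x (p + 1)) 0‖ ≤ η := by
      have := hx p (by omega)
      rw [← norm_neg] at this
      refine le_trans (le_of_eq ?_) this
      congr 1
      simp only [flow, remainder, add_zero]
      abel
    have h4 := norm_add_le (flow μ σ z a h p (x p) (j + 1) - flow μ σ z a h (p + 1) (x (p + 1)) j)
      (flow μ σ z a h (p + 1) (x (p + 1)) j - x (p + 1 + j))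
    rw [sub_add_sub_cancel, hidx] at h4
    rw [hidx] at h1
    have h5 := h2.trans (mul_le_mul_of_nonneg_left h3 (by positivity))
    push_cast
    linarith

end Telescope

/-! ### Powers of the mesh -/

section Mesh

variable {d d' : ℕ} {α K L M : ℝ}

theorem mesh_pos (n : ℕ) : 0 < mesh n := by unfold mesh; positivity

theorem tendsto_mesh : Filter.Tendsto mesh Filter.atTop (nhds 0) := by
  have e : mesh = fun n => (1 / 2 : ℝ) ^ n := by funext n; rw [mesh, div_pow, one_pow]
  rw [e]
  exact tendsto_pow_atTop_nhds_zero_of_lt_one (by norm_num) (by norm_num)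

theorem gridPoint_eq (n k : ℕ) : gridPoint n k = 0 + k * mesh n := by
  rw [gridPoint, mesh]; ring

theorem eventually_mul_mesh_le {c e : ℝ} (he : 0 < e) :
    ∀ᶠ n in Filter.atTop, c * mesh n ≤ e := by
  have h : Filter.Tendsto (fun n => c * mesh n) Filter.atTop (nhds 0) := by
    simpa using tendsto_mesh.const_mul c
  exact (h.eventually_lt_const he).mono fun n hn => hn.le

/-- The exponents differ by α - (3α-1) = 1 - 2α > 0. -/
theorem eventually_mul_mesh_rpow_le {Q C : ℝ} (hC : 0 < C) (hα : α < 1 / 2) :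
    ∀ᶠ n in Filter.atTop, Q * mesh n ^ α ≤ C * mesh n ^ (3 * α - 1) := by
  have h : Filter.Tendsto (fun n => Q * mesh n ^ (1 - 2 * α)) Filter.atTop (nhds 0) := by
    have := (tendsto_mesh.rpow_const (p := 1 - 2 * α) (Or.inr (by linarith))).const_mul Q
    rwa [Real.zero_rpow (by linarith), mul_zero] at this
  filter_upwards [h.eventually_lt_const hC] with n hn
  have e : mesh n ^ α = mesh n ^ (1 - 2 * α) * mesh n ^ (3 * α - 1) := by
    rw [← Real.rpow_add (mesh_pos n)]; ring_nf
  rw [e, ← mul_assoc]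
  exact mul_le_mul_of_nonneg_right hn.le (Real.rpow_nonneg (mesh_pos n).le _)

theorem constC3_pos (hα : 1 / 3 < α) (hd : d ≠ 0) (hM : 0 < M) (hK : 0 ≤ K) (hL : 0 ≤ L) :
    0 < constC3 d d' α M K L := by
  have h1 := constC1_pos (d := d) (d' := d') hα hM.le hK hL
  have h2 := constC2_pos (d := d) (d' := d') hα hM.le hK hL
  have h3 := one_sub_two_rpow_pos hα
  have h4 : (0 : ℝ) < d := Nat.cast_pos.2 (Nat.pos_of_ne_zero hd)
  unfold constC3 kappa
  positivity

/-- For M = 0 the left side vanishes; otherwise C₃ > 0 and the smaller order of Δ^α decides. The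
threshold depends on the constants alone. -/
theorem eventually_interpolation_le (hα : 1 / 3 < α) (hα2 : α < 1 / 2) (hd : d ≠ 0) (hM : 0 ≤ M)
    (hK : 0 ≤ K) (hL : 0 ≤ L) : ∀ᶠ n in Filter.atTop,
      (M + d' * M * K + d * d' ^ 2 * M ^ 2 * L) * mesh n ^ α
        ≤ constC3 d d' α M K L * mesh n ^ (3 * α - 1) := by
  obtain rfl | hM := hM.eq_or_lt
  · refine Filter.Eventually.of_forall fun n => ?_
    have h1 := constC3_nonneg (d := d) (d' := d') hα le_rfl hK hL
    have h2 := Real.rpow_nonneg (mesh_pos n).le (3 * α - 1)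
    simpa using mul_nonneg h1 h2
  · exact eventually_mul_mesh_rpow_le (constC3_pos hα hd hM hK hL) hα2

theorem mul_rpow_cube_mesh (n : ℕ) : (2 : ℝ) ^ n * (mesh n ^ α) ^ 3 = mesh n ^ (3 * α - 1) := by
  have hm := mesh_pos n
  rw [Real.rpow_sub hm, Real.rpow_one, mul_comm 3 α, Real.rpow_mul hm.le, eq_div_iff hm.ne', mesh]
  have : (2 : ℝ) ^ n ≠ 0 := by positivity
  norm_cast
  field_simp

end Mesh

/-! ### The scheme against the solution -/

section Scheme

variable {d d' : ℕ} {α K L M : ℝ} {Z : ℝ → Fin d' → ℝ} {A : ℝ → ℝ → Fin d' → Fin d' → ℝ}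
  {μ : (Fin d → ℝ) → Fin d → ℝ} {σ : (Fin d → ℝ) → Fin d → Fin d' → ℝ} {x₀ : Fin d → ℝ}
  {X : ℝ → Fin d → ℝ}

theorem schemeGrid_eq_flow (n k : ℕ) : schemeGrid μ σ Z A x₀ n k
    = flow μ σ (samplePath Z 0 (mesh n)) (sampleArea A 0 (mesh n)) (mesh n) 0 x₀ k := by
  induction k with
  | zero => rfl
  | succ k ih =>
    rw [schemeGrid, flow, ih, zero_add, gridIncrement_sample (Nat.lt_succ_self k), gridPoint_eq,
      gridPoint_eq]

theorem norm_schemeGrid_sub_le (hc : CoeffBounds μ σ M) (hM : 0 ≤ M) (hK : 0 ≤ K) (hL : 0 ≤ L)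
    (hα : 1 / 3 < α) (hα2 : α ≤ 1 / 2) (hZ : pathNorm α Z ≤ ENNReal.ofReal K)
    (hA : areaNorm α A ≤ ENNReal.ofReal L) (hX : IsSolution μ σ Z A x₀ X) {n : ℕ}
    (hh : 3 * mesh n ≤ delta d d' α M K L) (hh' : 3 * mesh n ≤ delta' d d' α M K L) {k : ℕ}
    (hk : k ≤ 2 ^ n) : ‖schemeGrid μ σ Z A x₀ n k - X (k * mesh n)‖
      ≤ 2 ^ (2 / delta' d d' α M K L) * constC3 d d' α M K L * mesh n ^ (3 * α - 1) := by
  have hm := mesh_pos n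
  have hNm : ((2 ^ n : ℕ) : ℝ) * mesh n = 1 := by
    rw [mesh]; push_cast; field_simp
  have hD := gridDriver_sample (N := 2 ^ n) (by linarith) hK hL hZ hA hX.area hm le_rfl
    (by linarith)
  have h1 := norm_flow_sub_le (x := fun k : ℕ => X (0 + k * mesh n))
    (η := constC3 d d' α M K L * (mesh n ^ α) ^ 3) hc hM hK hL hα hα2 hD hh hh'
    (fun k hk => by
      rw [remainder, gridIncrement_sample (Nat.lt_succ_self k)]
      have hle : ((k + 1 : ℕ) : ℝ) * mesh n ≤ 1 := by
        rw [← hNm]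
        exact mul_le_mul_of_nonneg_right (Nat.cast_le.2 hk) hm.le
      have := hX.norm_remainder_le hc hM hK hL hα hα2 hZ hA (s := 0 + k * mesh n)
        (t := 0 + ((k + 1 : ℕ) : ℝ) * mesh n) (by positivity) (by push_cast; linarith)
        (by linarith)
      rwa [sub_eq_span, span_succ] at this) k 0 (by omega)
  have hx0 : X (0 + ((0 : ℕ) : ℝ) * mesh n) = x₀ := by simpa using hX.initial
  rw [hx0, ← schemeGrid_eq_flow, zero_add, zero_add] at h1
  refine h1.trans ?_
  rw [← mul_rpow_cube_mesh]
  have hC := constC3_nonneg (d := d) (d' := d') hα hM hK hL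
  have hkn : (k : ℝ) ≤ 2 ^ n := by exact_mod_cast hk
  have hω := Real.rpow_nonneg hm.le α
  calc (k : ℝ) * (2 ^ (2 / delta' d d' α M K L) * (constC3 d d' α M K L * (mesh n ^ α) ^ 3))
      ≤ 2 ^ n * (2 ^ (2 / delta' d d' α M K L) * (constC3 d d' α M K L * (mesh n ^ α) ^ 3)) := by
        gcongr
    _ = _ := by ring

theorem norm_sub_grid_le (hc : CoeffBounds μ σ M) (hM : 0 ≤ M) (hK : 0 ≤ K) (hL : 0 ≤ L)
    (hα : 1 / 3 < α) (hα2 : α ≤ 1 / 2) (hZ : pathNorm α Z ≤ ENNReal.ofReal K)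
    (hA : areaNorm α A ≤ ENNReal.ofReal L) (hX : IsSolution μ σ Z A x₀ X) {h s t : ℝ} (hs : 0 ≤ s)
    (hst : s ≤ t) (ht : t ≤ 1) (hh : t - s ≤ h) : ‖X s - X t‖
      ≤ (M + d' * M * K + d * d' ^ 2 * M ^ 2 * L) * h ^ α
        + constC3 d d' α M K L * (h ^ α) ^ 3 := by
  have hα0 : 0 < α := by linarith
  have hC := constC3_nonneg (d := d) (d' := d') hα hM hK hL
  have hh0 : 0 ≤ h := (sub_nonneg.2 hst).trans hh
  have hω := Real.rpow_nonneg hh0 α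
  obtain rfl | hst := hst.eq_or_lt
  · rw [sub_self, norm_zero]; positivity
  have h1 := hX.norm_remainder_le hc hM hK hL hα hα2 hZ hA hs hst ht
  have h2 := norm_increment_le hc hM hK hL hα0 hα2 hZ hA hX.area hs hst ht (X s)
  have h3 := norm_add_le (X t - X s - increment μ σ Z A s t (X s)) (increment μ σ Z A s t (X s))
  rw [sub_add_cancel] at h3
  have hω' := Real.rpow_nonneg (sub_pos.2 hst).le α
  have hmono : (t - s) ^ α ≤ h ^ α := Real.rpow_le_rpow (sub_pos.2 hst).le hh hα0.le
  have h1' : constC3 d d' α M K L * ((t - s) ^ α) ^ 3 ≤ constC3 d d' α M K L * (h ^ α) ^ 3 := by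
    gcongr
  have h2' : (M + d' * M * K + d * d' ^ 2 * M ^ 2 * L) * (t - s) ^ α
      ≤ (M + d' * M * K + d * d' ^ 2 * M ^ 2 * L) * h ^ α := by gcongr
  rw [norm_sub_rev]
  linarith

theorem lipschitz_add_one_le_constB (hα : 1 / 3 < α) (hM : 0 ≤ M) (hK : 0 ≤ K) (hL : 0 ≤ L) :
    2 ^ (2 / delta' d d' α M K L) + 1 ≤ constB d d' α M K L := by
  have hB3 := locB3_nonneg (d := d) (d' := d') hα hM hK hL
  have hB1 : 0 ≤ locB1 d d' M K L := by unfold locB1; positivity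
  have h1 : (0 : ℝ) < 2 ^ (2 / delta' d d' α M K L) := by positivity
  unfold constB
  nlinarith [mul_nonneg (by linarith : (0 : ℝ) ≤ 1 + 2 * locB1 d d' M K L + locB3 d d' α M K L)
    (by linarith : (0 : ℝ) ≤ 1 + 2 ^ (2 / delta' d d' α M K L))]

end Scheme

end RoughMilstein

open RoughMilstein in
theorem mainTheorem3 (d d' : ℕ) (α : ℝ) (hα : α ∈ Set.Ioo (1 / 3 : ℝ) (1 / 2))
    (M K L : ℝ) (hM : 0 ≤ M) (hK : 0 ≤ K) (hL : 0 ≤ L) :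
    ∃ n₀ : ℕ, ∀ (μ : (Fin d → ℝ) → Fin d → ℝ) (σ : (Fin d → ℝ) → Fin d → Fin d' → ℝ),
      CoeffBounds μ σ M →
      ∀ (Z : ℝ → Fin d' → ℝ) (A : ℝ → ℝ → Fin d' → Fin d' → ℝ),
      pathNorm α Z ≤ ENNReal.ofReal K → areaNorm α A ≤ ENNReal.ofReal L →
      ∀ (x₀ : Fin d → ℝ) (X : ℝ → Fin d → ℝ), IsSolution μ σ Z A x₀ X →
      ∀ n ≥ n₀, ∀ t ∈ Set.Icc (0 : ℝ) 1,
        ‖scheme μ σ Z A x₀ n t - X t‖ ≤ constG1 d d' α M K L * mesh n ^ (3 * α - 1) := by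
  obtain ⟨hα1, hα2⟩ := hα
  have hC := constC3_nonneg (d := d) (d' := d') hα1 hM hK hL
  have hB := lipschitz_add_one_le_constB (d := d) (d' := d') hα1 hM hK hL
  have h2 : (0 : ℝ) < 2 ^ (2 / delta' d d' α M K L) := by positivity
  obtain rfl | hd := eq_or_ne d 0
  -- For d = 0 the constant C₃ is zero, so the interpolation estimate may fail; the state space is a
  -- single point, however.
  · refine ⟨0, fun μ σ _ Z A _ _ x₀ X _ n _ t _ => ?_⟩
    rw [Subsingleton.elim (scheme μ σ Z A x₀ n t - X t) 0, norm_zero]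
    exact mul_nonneg (mul_nonneg (by linarith) hC) (Real.rpow_nonneg (mesh_pos n).le _)
  obtain ⟨n₀, hn₀⟩ := Filter.eventually_atTop.1
    (((eventually_mul_mesh_le (c := 3) (delta_pos (d := d) (d' := d') hα1 hM hK hL)).and
      (eventually_mul_mesh_le (c := 3) (delta'_pos (d := d) (d' := d') hα1 hM hK hL))).and
      (eventually_interpolation_le (d' := d') hα1 hα2 hd hM hK hL))
  refine ⟨n₀, fun μ σ hc Z A hZ hA x₀ X hX n hn t ht => ?_⟩
  obtain ⟨⟨hh, hh'⟩, hint⟩ := hn₀ n hn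
  have hm := mesh_pos n
  have hpow : (0 : ℝ) < 2 ^ n := by positivity
  have hmesh : mesh n = 1 / 2 ^ n := rfl
  have hk : ⌊2 ^ n * t⌋₊ ≤ 2 ^ n := by
    refine Nat.floor_le_of_le ?_
    push_cast
    exact mul_le_of_le_one_right hpow.le ht.2
  have hkt : (⌊2 ^ n * t⌋₊ : ℝ) * mesh n ≤ t := by
    rw [hmesh, mul_one_div, div_le_iff₀ hpow, mul_comm t]
    exact Nat.floor_le (mul_nonneg hpow.le ht.1)
  have htk : t - ⌊2 ^ n * t⌋₊ * mesh n ≤ mesh n := by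
    have := (Nat.lt_floor_add_one (2 ^ n * t)).le
    rw [hmesh, mul_one_div, sub_le_iff_le_add, ← add_div, le_div_iff₀ hpow, mul_comm t]
    linarith
  have e1 := norm_schemeGrid_sub_le hc hM hK hL hα1 hα2.le hZ hA hX hh hh' hk
  have e2 := norm_sub_grid_le hc hM hK hL hα1 hα2.le hZ hA hX (by positivity) hkt ht.2 htk
  have e3 := norm_add_le (schemeGrid μ σ Z A x₀ n ⌊2 ^ n * t⌋₊ - X (⌊2 ^ n * t⌋₊ * mesh n))
    (X (⌊2 ^ n * t⌋₊ * mesh n) - X t)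
  rw [sub_add_sub_cancel] at e3
  have e4 : constC3 d d' α M K L * (mesh n ^ α) ^ 3
      ≤ constC3 d d' α M K L * mesh n ^ (3 * α - 1) := by
    rw [← mul_rpow_cube_mesh]
    have := Real.rpow_nonneg hm.le α
    exact mul_le_mul_of_nonneg_left
      (le_mul_of_one_le_left (by positivity) (one_le_pow₀ one_le_two)) hC
  -- In units of C₃Δ^(3α-1) the error at the grid point costs 2^(2/δ'), while the increment and the
  -- remainder of the solution within a cell cost 1 each; the total 2^(2/δ') + 2 is at most 1 + B.
  have e5 := mul_le_mul_of_nonneg_right hB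
    (mul_nonneg hC (Real.rpow_nonneg hm.le (3 * α - 1)))
  rw [constG1, scheme]
  linarith
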